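/- **Theorem (unordered multinomial probit model).** Let $K\ge 2$, let $X$ be a random element of $L^1[0,1]$ with law $G$, and suppose that $\|X\|_1=\int_0^1|X(t)|\,dt$ is almost surely bounded by a constant. For coefficient functions $\beta=(\beta_1,\dots,\beta_{K-1})$ on $[0,1]$ let $$W_l=\int_0^1\beta_l(t)X(t)\,dt+\varepsilon_l,\qquad l=1,\dots,K-1,$$ where $(\varepsilon_1,\dots,\varepsilon_{K-1})\sim N(0,\Sigma)$ is independent of $X$, and $\Sigma$ has $2$ on the diagonal and $1$ off the diagonal (that is, $\varepsilon_l=\varepsilon'_l-\varepsilon'_K$ with $\varepsilon'_1,\dots,\varepsilon'_K$ i.i.d. $N(0,1)$). Put $\pi_k(X)=P(W_k>W_l\text{ for all }l\ne k,\ W_k>0\mid X)$ for $k<K$ and $\pi_K(X)=P(W_l<0\text{ for all }l\mid X)$. Let $(X_1,Y_1),\dots,(X_n,Y_n)$ be i.i.d. with $X_i\sim G$ and $P(Y_i=k\mid X_i)=\pi_{0k}(X_i)$, where $\pi_0$ is given by the true coefficient functions $\beta_{01},\dots,\beta_{0,K-1}$, and let $$d(\pi,\pi_0)=\Big(\sum_{k=1}^K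 E_X|\pi_k(X)-\pi_{0k}(X)|^2\Big)^{1/2}.$$ *Prior.* For each $J$ let $\psi_J=(\psi_{J,1},\dots,\psi_{J,J})$ be measurable basis functions. The prior on $\beta$ is the law of $\beta_l=\theta_l^T\psi_J$, $l<K$, where $J$ is random and, given $J$, $\Theta=(\theta_1,\dots,\theta_{K-1})\in(\mathbb R^J)^{K-1}$ has an arbitrary joint law, such that, with numbers $0\le t_2\le t_1\le 1$, $H$, and with constants $c_1,c_2,c_3,C,t_3,\epsilon_0,M_0>0$ and $s\ge0$ not depending on $J$: * (A1) $\exp\{-c_1 j\log^{t_1}j\}\le\Pi(J=j)\le\exp\{-c_2 j\log^{t_2}j\}$ for all sufficiently large $j$; * (A2) for all $J\ge1$, all $\Theta_0$ with $\|\Theta_0\|_\infty\le H$ and all $0<\epsilon\le\epsilon_0J^{-s}$, $\Pi(\|\Theta-\Theta_0\|_2\le\epsilon\mid J)\ge\exp\{-c_3J\log(1/\epsilon)\}$; and for all $J$ and all $M\ge M_0$, the conditional probability given $J$ that some entry of $\Theta$ lies outside $[-M,M]$ is at most $J\exp\{-CM^{t_3}\}$. *Basis.* Assume that, for some $\alpha>0$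 and $K_0\ge0$, and constants $C_1,C_2$ not depending on $J\geq 1$, * (5.10) for every $l<K$ and $J\ge1$ there is $\theta_0\in\mathbb R^J$ with $\|\theta_0\|_\infty\le H$ and $\sup_{t\in[0,1]}|\beta_{0l}(t)-\theta_0^T\psi_J(t)|\le C_1J^{-\alpha}$; * (5.11) $\sup_{t\in[0,1]}|\theta_1^T\psi_J(t)-\theta_2^T\psi_J(t)|\le C_2J^{K_0}\|\theta_1-\theta_2\|_2$ for all $J\geq 1$ and $\theta_1,\theta_2\in\mathbb R^J$. Then, for every positive sequence $\epsilon_n\asymp n^{-\alpha/(2\alpha+1)}(\log n)^{\alpha/(2\alpha+1)+(1-t_2)/2}$, the posterior contracts at rate $\epsilon_n$ relative to $d$: for every $M_n\to\infty$, $$\Pi\big(d(\pi,\pi_0)\ge M_n\epsilon_n\,\big|\,X_1,Y_1,\dots,X_n,Y_n\big)\to0\quad\text{in probability under the true law of the data.}$$ -/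

import Mathlib

open MeasureTheory ProbabilityTheory Filter Topology Asymptotics

noncomputable section

namespace FunProbit

/-- The space `L¹[0,1]` in which the functional covariate takes its values. -/
abbrev Curve : Type := Lp ℝ 1 (volume.restrict (Set.Icc (0 : ℝ) 1))

instance instMeasurableSpaceCurve : MeasurableSpace Curve := borel Curve

instance instBorelSpaceCurve : BorelSpace Curve := ⟨rfl⟩

/-! ### The unordered multinomial probit model with `K = q + 1` categories

The category `K` is `Fin.last q`; the categories `1, …, K - 1` are `i.castSucc` for `i : Fin q`. -/

/-- The law of `(ε'_l - ε'_K)_{l < K}` for i.i.d. standard normal `ε'_1, …, ε'_K`: the centred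
normal law whose covariance matrix has `2` on the diagonal and `1` off the diagonal. -/
def latentNoise (q : ℕ) : Measure (Fin q → ℝ) :=
  (Measure.pi (fun _ : Fin (q + 1) => gaussianReal 0 1)).map
    (fun e l => e l.castSucc - e (Fin.last q))

/-- The latent vector `w = (w_1, …, w_{K-1})` selects category `k`: for `k < K` this means
`w_k > w_l` for all `l ≠ k` and `w_k > 0`; for `k = K` it means `w_l < 0` for all `l`. -/
def Selects {q : ℕ} (w : Fin q → ℝ) (k : Fin (q + 1)) : Prop :=
  Fin.lastCases (motive := fun _ => Prop)
    (∀ l, w l < 0)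
    (fun i => (∀ l, l ≠ i → w l < w i) ∧ 0 < w i) k

/-- The linear predictor `∫₀¹ β(t) x(t) dt`. -/
def linPred (β : ℝ → ℝ) (x : Curve) : ℝ :=
  ∫ t in Set.Icc (0 : ℝ) 1, β t * x t

/-- `π_k(x) = P(Y = k | X = x)` for coefficient functions `β_1, …, β_{K-1}`: the probability that
`W_l = ∫ β_l x + ε_l`, `l < K`, selects `k`. -/
def catProb {q : ℕ} (β : Fin q → ℝ → ℝ) (x : Curve) (k : Fin (q + 1)) : ℝ :=
  (latentNoise q).real {e | Selects (fun l => linPred (β l) x + e l) k}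

/-- The joint law of one observation `(X, Y)` when `X` has law `G`: it has density `π_y(x)` with
respect to the product of `G` and the counting measure on the categories. -/
def obsLaw {q : ℕ} (G : Measure Curve) (β : Fin q → ℝ → ℝ) : Measure (Curve × Fin (q + 1)) :=
  (G.prod Measure.count).withDensity (fun z => ENNReal.ofReal (catProb β z.1 z.2))

/-- The distance `d(π, π')`, the square root of `∑_k E_X |π_k(X) - π'_k(X)|²`, between the
category probabilities of two vectors of coefficient functions. -/
def catDist {q : ℕ} (G : Measure Curve) (β β' : Fin q → ℝ → ℝ) : ℝ :=
  Real.sqrt (∑ k : Fin (q + 1), ∫ x, |catProb β x k - catProb β' x k| ^ 2 ∂G)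

/-! ### Finite random series priors and the posterior -/

/-- The coefficient parameter `(J, Θ)`: `Θ l j` is the coefficient of the `j`-th of `J` basis
functions in `β_l`. -/
abbrev Param (q : ℕ) : Type := Σ J : ℕ, (Fin q → Fin J → ℝ)

/-- The finite series `θᵀψ`, where `ψ J 0, …, ψ J (J - 1)` are the basis functions used in
dimension `J`. -/
def series (ψ : (J : ℕ) → Fin J → ℝ → ℝ) {J : ℕ} (θ : Fin J → ℝ) (t : ℝ) : ℝ :=
  ∑ j, θ j * ψ J j t

/-- The coefficient functions `β_l = θ_lᵀψ` given by a parameter `(J, Θ)`. -/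
def coefFun {q : ℕ} (ψ : (J : ℕ) → Fin J → ℝ → ℝ) (p : Param q) : Fin q → ℝ → ℝ :=
  fun l => series ψ (p.2 l)

/-- The prior: `J` has law `ρ`, and given `J` the coefficients `Θ` have law `τ J`. -/
def prior {q : ℕ} (ρ : Measure ℕ) (τ : (J : ℕ) → Measure (Fin q → Fin J → ℝ)) :
    Measure (Param q) :=
  Measure.sum (fun J => ρ {J} • (τ J).map (Sigma.mk J))

/-- The likelihood of a parameter given the observations `(X_1, Y_1), …, (X_n, Y_n)`. -/
def likelihood {q n : ℕ} (ψ : (J : ℕ) → Fin J → ℝ → ℝ) (D : Fin n → Curve × Fin (q + 1))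
    (p : Param q) : ENNReal :=
  ∏ i, ENNReal.ofReal (catProb (coefFun ψ p) (D i).1 (D i).2)

/-- The posterior probability of a set `B` of parameters, by Bayes's formula. -/
def posteriorProb {q n : ℕ} (P : Measure (Param q)) (ψ : (J : ℕ) → Fin J → ℝ → ℝ)
    (D : Fin n → Curve × Fin (q + 1)) (B : Set (Param q)) : ENNReal :=
  (∫⁻ p in B, likelihood ψ D p ∂P) / ∫⁻ p, likelihood ψ D p ∂P

/-- The posterior contracts at rate `r` at the true coefficient functions `β₀`, relative to
`catDist`: for all `M_n → ∞`, the posterior probability of `d(π, π₀) ≥ M_n r_n` tends to `0` in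
probability under the law of `n` i.i.d. observations with true coefficient functions `β₀`. -/
def ContractsAt {q : ℕ} (G : Measure Curve) (P : Measure (Param q))
    (ψ : (J : ℕ) → Fin J → ℝ → ℝ) (β₀ : Fin q → ℝ → ℝ) (r : ℕ → ℝ) : Prop :=
  ∀ M : ℕ → ℝ, Tendsto M atTop atTop →
    ∀ δ : ENNReal, 0 < δ →
      Tendsto
        (fun n : ℕ => Measure.pi (fun _ : Fin n => obsLaw G β₀)
          {D | δ ≤ posteriorProb P ψ D {p | M n * r n ≤ catDist G (coefFun ψ p) β₀}})
        atTop (𝓝 0)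

/-! ### Conditions on the prior and the basis -/

/-- The condition on the law `ρ` of `J`:
`exp(-c₁ j log^{t₁} j) ≤ ρ(J = j) ≤ exp(-c₂ j log^{t₂} j)` for all large `j`. -/
def DimPriorCond (ρ : Measure ℕ) (t₁ t₂ : ℝ) : Prop :=
  ∃ c₁ > (0 : ℝ), ∃ c₂ > (0 : ℝ), ∃ j₀ : ℕ, ∀ j ≥ j₀,
    Real.exp (-c₁ * j * Real.log j ^ t₁) ≤ ρ.real {j} ∧
      ρ.real {j} ≤ Real.exp (-c₂ * j * Real.log j ^ t₂)

/-- The small-ball condition on the law `τ J` of the coefficients given `J`. The range in which `ε`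
is small enough may shrink polynomially in `J`: a range `(0, ε₀]` that is the same for all `J`
(the case `s = 0`) is impossible for every family of probability laws when `H > 0`, because the cube
`[-H, H]^J` contains too many disjoint `ε`-balls. -/
def CoefPriorConc {q : ℕ} (τ : (J : ℕ) → Measure (Fin q → Fin J → ℝ)) (H : ℝ) : Prop :=
  ∃ c₃ > (0 : ℝ), ∃ ε₀ > (0 : ℝ), ∃ s ≥ (0 : ℝ), ∀ J : ℕ, 1 ≤ J →
    ∀ Θ₀ : Fin q → Fin J → ℝ, (∀ l j, |Θ₀ l j| ≤ H) →
      ∀ ε : ℝ, 0 < ε → ε ≤ ε₀ * (J : ℝ) ^ (-s) →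
        Real.exp (-c₃ * J * Real.log (1 / ε)) ≤
          (τ J).real {Θ | Real.sqrt (∑ l, ∑ j, (Θ l j - Θ₀ l j) ^ 2) ≤ ε}

/-- The tail condition on the law `τ J` of the coefficients given `J`: the probability that some
coefficient lies outside `[-M, M]` is at most `J exp(-C M^{t₃})`, for all large `M`. -/
def CoefPriorTail {q : ℕ} (τ : (J : ℕ) → Measure (Fin q → Fin J → ℝ)) : Prop :=
  ∃ C > (0 : ℝ), ∃ t₃ > (0 : ℝ), ∃ M₀ > (0 : ℝ), ∀ J : ℕ, ∀ M ≥ M₀,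
    (τ J).real {Θ | ∃ l j, M < |Θ l j|} ≤ J * Real.exp (-C * M ^ t₃)

/-- Approximation of `β₀` by the basis in the uniform norm, at rate `J^{-α}`, by coefficient vectors
bounded by `H`. -/
def BasisApprox (ψ : (J : ℕ) → Fin J → ℝ → ℝ) (β₀ : ℝ → ℝ) (α H : ℝ) : Prop :=
  ∃ C > (0 : ℝ), ∀ J : ℕ, 1 ≤ J → ∃ θ₀ : Fin J → ℝ, (∀ j, |θ₀ j| ≤ H) ∧
    ∀ t ∈ Set.Icc (0 : ℝ) 1, |β₀ t - series ψ θ₀ t| ≤ C * (J : ℝ) ^ (-α)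

/-- Stability of the basis in the uniform norm, with exponent `K₀`. -/
def BasisStable (ψ : (J : ℕ) → Fin J → ℝ → ℝ) (K₀ : ℝ) : Prop :=
  ∃ C > (0 : ℝ), ∀ J : ℕ, 1 ≤ J → ∀ θ₁ θ₂ : Fin J → ℝ, ∀ t ∈ Set.Icc (0 : ℝ) 1,
    |series ψ θ₁ t - series ψ θ₂ t| ≤
      C * (J : ℝ) ^ K₀ * Real.sqrt (∑ j, (θ₁ j - θ₂ j) ^ 2)

end FunProbit

end

namespace FunProbit

/-! ### The category probabilities as functions of the linear predictor -/

/-! The proof bounds the posterior directly by Markov's inequality for likelihood ratios; no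
abstract contraction theorem is used. Three facts about the model suffice. The category
probabilities are Lipschitz in the linear predictors, because a difference of two noise variables
has bounded density (`abs_selProb_sub_le`). They are bounded away from zero on bounded sets of
predictors (`exists_pos_le_selProb`). Since `‖X‖` is bounded, uniform closeness of the coefficient
functions therefore gives uniform closeness of the category probabilities (`abs_catProb_sub_le`).

The posterior probability of a set far from the truth is a quotient of integrated likelihood ratios.
The denominator is bounded below through a ball of parameters around an approximation of the truth:
there the chi-square divergence is of the order of the squared approximation error, and an
inequality of AM-GM type turns the mean of inverse ratios into a lower bound for the integral of
ratios (`measure_evidence_lt_le`). In the numerator, the part outside a sieve has mean at most the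
prior mass of the complement (`StableBasis.measure_sieve_compl_le`). The sieve itself is cut into
small cells; in each cell one upper bracket dominates all likelihoods, and the affinity of this
bracket with the true density is at most `exp(-d²/8)` up to a negligible factor, so that a union
bound over the cells controls all ratios at once (`StableBasis.measure_sieve_le`).

Rates: let `y = (n / log n)^{1/(2α+1)}` and `S = y log n = n y^{-2α}`. A ball in dimension `⌈y⌉` has
bias of order `y^{-α}` and prior mass at least `exp(-cS)`, so the evidence is at least `exp(-aS)`.
To have prior mass below `exp(-(a+2)S)` outside the sieve, dimensions up to a multiple of `y (log
n)^{1-t₂}` are needed, because the prior on the dimension may have tails as heavy as `exp(-c₂ j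
log^{t₂} j)`. The log-number of cells is then of order `S (log n)^{1-t₂}`, which equals `n` times
the squared rate; this is the source of the extra factor `(log n)^{(1-t₂)/2}`. -/

/-- The law of `q + 1` independent standard normal variables. -/
noncomputable def stdNoise (q : ℕ) : Measure (Fin (q + 1) → ℝ) :=
  Measure.pi (fun _ => gaussianReal 0 1)

instance (q : ℕ) : IsProbabilityMeasure (stdNoise q) := by
  unfold stdNoise; infer_instance

instance (q : ℕ) : IsProbabilityMeasure (latentNoise q) := by
  unfold latentNoise
  exact Measure.isProbabilityMeasure_map (Measurable.aemeasurable (by fun_prop))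

/-- The probability of category `k` at the linear predictor `a`. -/
noncomputable def selProb {q : ℕ} (a : Fin q → ℝ) (k : Fin (q + 1)) : ℝ :=
  (latentNoise q).real {e | Selects (fun l => a l + e l) k}

/-- The linear predictor extended by the value `0` for the last category. -/
noncomputable def extPred {q : ℕ} (a : Fin q → ℝ) : Fin (q + 1) → ℝ :=
  Fin.snoc (α := fun _ => ℝ) a 0

/-- The noise vectors for which category `k` has the strictly largest utility. -/
def winSet {q : ℕ} (a : Fin q → ℝ) (k : Fin (q + 1)) : Set (Fin (q + 1) → ℝ) :=
  {e | ∀ l, l ≠ k → extPred a l + e l < extPred a k + e k}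

lemma measurableSet_selects {q : ℕ} (a : Fin q → ℝ) (k : Fin (q + 1)) :
    MeasurableSet {e : Fin q → ℝ | Selects (fun l => a l + e l) k} := by
  induction k using Fin.lastCases with
  | last =>
    simp only [Selects, Fin.lastCases_last]
    rw [Set.ofPred_forall]
    exact MeasurableSet.iInter fun l => measurableSet_lt (by fun_prop) (by fun_prop)
  | cast i =>
    simp only [Selects, Fin.lastCases_castSucc]
    rw [Set.ofPred_and]
    refine MeasurableSet.inter ?_ (measurableSet_lt (by fun_prop) (by fun_prop))
    rw [Set.ofPred_forall]
    refine MeasurableSet.iInter fun l => ?_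
    by_cases h : l = i
    · simp [h]
    · simp only [ne_eq, h, not_false_eq_true, forall_const]
      exact measurableSet_lt (by fun_prop) (by fun_prop)

lemma measurableSet_winSet {q : ℕ} (a : Fin q → ℝ) (k : Fin (q + 1)) :
    MeasurableSet (winSet a k) := by
  unfold winSet
  rw [Set.ofPred_forall]
  refine MeasurableSet.iInter fun l => ?_
  by_cases h : l = k
  · simp [h]
  · simp only [ne_eq, h, not_false_eq_true, forall_const]
    exact measurableSet_lt (by fun_prop) (by fun_prop)

/-- Adding the last noise variable to every latent value turns the threshold `0` into the utility of
the last category, so all categories are treated alike from here on. -/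
lemma selects_iff {q : ℕ} (a : Fin q → ℝ) (e : Fin (q + 1) → ℝ) (k : Fin (q + 1)) :
    Selects (fun l => a l + (e l.castSucc - e (Fin.last q))) k ↔ e ∈ winSet a k := by
  induction k using Fin.lastCases with
  | last =>
    simp only [Selects, Fin.lastCases_last, winSet, Set.mem_ofPred_eq, extPred, Fin.snoc_last,
      zero_add, Fin.forall_fin_succ', ne_eq, not_true_eq_false, false_imp_iff, and_true,
      Fin.snoc_castSucc]
    refine forall_congr' fun l => ?_
    have : l.castSucc ≠ Fin.last q := (Fin.castSucc_lt_last l).ne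
    simp only [this, not_false_eq_true, forall_const]
    constructor <;> intro h <;> linarith
  | cast i =>
    simp only [Selects, Fin.lastCases_castSucc, winSet, Set.mem_ofPred_eq, extPred,
      Fin.forall_fin_succ', ne_eq, Fin.snoc_castSucc, Fin.snoc_last, zero_add]
    have h0 : Fin.last q ≠ i.castSucc := (Fin.castSucc_lt_last i).ne'
    simp only [h0, not_false_eq_true, forall_const, Fin.castSucc_inj]
    refine and_congr (forall₂_congr fun l _ => ?_) ?_ <;>
      constructor <;> intro h <;> linarith

lemma selProb_eq {q : ℕ} (a : Fin q → ℝ) (k : Fin (q + 1)) :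
    selProb a k = (stdNoise q).real (winSet a k) := by
  unfold selProb latentNoise
  rw [measureReal_def, Measure.map_apply (by fun_prop) (measurableSet_selects a k), measureReal_def]
  congr 2
  ext e
  exact selects_iff a e k

lemma selProb_le_one {q : ℕ} (a : Fin q → ℝ) (k : Fin (q + 1)) : selProb a k ≤ 1 :=
  measureReal_le_one

/-- The normalising factor `√(2πv)` is at least `1`, so the density is at most `1`. Applied with `v
= 2`, the variance of a difference of two noise variables. -/
lemma gaussianReal_real_le_volume {v : NNReal} (hv : 1 ≤ v) (s : Set ℝ) :
    gaussianReal 0 v s ≤ volume s := by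
  rw [gaussianReal_apply 0 (by positivity)]
  calc ∫⁻ x in s, gaussianPDF 0 v x ≤ ∫⁻ _ in s, 1 := by
        refine lintegral_mono fun x => ?_
        rw [gaussianPDF, ENNReal.ofReal_le_one, gaussianPDFReal]
        have h1 : (1 : ℝ) ≤ √(2 * Real.pi * v) := by
          rw [Real.one_le_sqrt]
          have : (1 : ℝ) ≤ v := hv
          nlinarith [Real.pi_gt_three]
        have h2 : Real.exp (-(x - 0) ^ 2 / (2 * v)) ≤ 1 := by
          rw [Real.exp_le_one_iff]
          have : 0 ≤ (x - 0) ^ 2 / (2 * v) := by positivity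
          rw [neg_div]; linarith
        calc _ ≤ (1 : ℝ) * 1 := by
              gcongr
              exact inv_le_one_of_one_le₀ h1
          _ = 1 := one_mul 1
    _ = volume s := by simp

lemma map_sub_stdNoise {q : ℕ} {l m : Fin (q + 1)} (h : l ≠ m) :
    (stdNoise q).map (fun e => e l - e m) = gaussianReal 0 2 := by
  have hi : iIndepFun (fun (i : Fin (q + 1)) (e : Fin (q + 1) → ℝ) => e i) (stdNoise q) :=
    iIndepFun_pi (X := fun _ x => x) (fun _ => aemeasurable_id)
  have hl : ∀ i, (stdNoise q).map (fun e => e i) = gaussianReal 0 1 := fun i =>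
    (measurePreserving_eval (fun _ : Fin (q + 1) => gaussianReal 0 1) i).map_eq
  have hm : (stdNoise q).map (fun e => -e m) = gaussianReal 0 1 := by
    have : (fun e : Fin (q + 1) → ℝ => -e m) = (fun x => -1 * x) ∘ (fun e => e m) := by
      ext; simp
    rw [this, ← Measure.map_map (by fun_prop) (by fun_prop), hl m, gaussianReal_map_const_mul]
    congr 1
    · simp
    · exact NNReal.eq (by simp)
  have := gaussianReal_add_gaussianReal_of_indepFun
    ((hi.indepFun h).comp (φ := fun x : ℝ => x) (ψ := fun x : ℝ => -x) (by fun_prop) (by fun_prop))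
    (hl l) hm
  have h2 : (0 : ℝ) + 0 = 0 ∧ (1 : NNReal) + 1 = 2 := by norm_num
  rw [h2.1, h2.2] at this
  rw [← this]
  congr 1

/-- Anti-concentration of differences of two independent standard normal variables. -/
lemma stdNoise_sub_mem_Icc_le {q : ℕ} {l m : Fin (q + 1)} (h : l ≠ m) (c : ℝ) {d : ℝ}
    (hd : 0 ≤ d) : (stdNoise q).real {e | e l - e m ∈ Set.Icc c (c + d)} ≤ d := by
  have h1 : (stdNoise q) {e | e l - e m ∈ Set.Icc c (c + d)}
      = gaussianReal 0 2 (Set.Icc c (c + d)) := by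
    rw [← map_sub_stdNoise h, Measure.map_apply (by fun_prop) measurableSet_Icc]; rfl
  rw [measureReal_def, h1]
  have h2 := gaussianReal_real_le_volume (v := 2) (by norm_num) (Set.Icc c (c + d))
  rw [Real.volume_Icc] at h2
  have h3 := ENNReal.toReal_mono ENNReal.ofReal_ne_top h2
  rwa [add_sub_cancel_left, ENNReal.toReal_ofReal hd] at h3

lemma extPred_sub_le {q : ℕ} {a b : Fin q → ℝ} {d : ℝ} (hd : 0 ≤ d) (h : ∀ l, |a l - b l| ≤ d)
    (k : Fin (q + 1)) : |extPred a k - extPred b k| ≤ d := by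
  induction k using Fin.lastCases with
  | last => simpa [extPred] using hd
  | cast i => simpa [extPred] using h i

lemma extPred_le {q : ℕ} {a : Fin q → ℝ} {d : ℝ} (hd : 0 ≤ d) (h : ∀ l, |a l| ≤ d)
    (k : Fin (q + 1)) : |extPred a k| ≤ d := by
  induction k using Fin.lastCases with
  | last => simpa [extPred] using hd
  | cast i => simpa [extPred] using h i

/-- If `k` wins at `a` but loses to `l` at `b`, then `e l - e k` lies in an interval of length `2d`,
an event of probability at most `2d`; sum over `l`. -/
lemma selProb_sub_le {q : ℕ} {a b : Fin q → ℝ} {d : ℝ} (hd : 0 ≤ d) (h : ∀ l, |a l - b l| ≤ d)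
    (k : Fin (q + 1)) : selProb a k - selProb b k ≤ (q + 1) * (2 * d) := by
  rw [selProb_eq, selProb_eq]
  let B : Fin (q + 1) → Set (Fin (q + 1) → ℝ) := fun l =>
    if l = k then ∅ else {e | e l - e k ∈ Set.Icc (extPred a k - extPred a l - 2 * d)
      (extPred a k - extPred a l - 2 * d + 2 * d)}
  have hB : ∀ l, (stdNoise q).real (B l) ≤ 2 * d := by
    intro l
    by_cases hl : l = k
    · simp [B, hl, hd]
    · simp only [B, hl, if_false]
      exact stdNoise_sub_mem_Icc_le hl _ (by linarith)
  have hsub : winSet a k ⊆ winSet b k ∪ ⋃ l, B l := by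
    intro e he
    by_cases hb : e ∈ winSet b k
    · exact Or.inl hb
    · right
      simp only [winSet, Set.mem_ofPred_eq, not_forall, not_lt] at hb
      obtain ⟨l, hl, hle⟩ := hb
      have h1 := he l hl
      have h2 := abs_le.1 (extPred_sub_le hd h l)
      have h3 := abs_le.1 (extPred_sub_le hd h k)
      refine Set.mem_iUnion.2 ⟨l, ?_⟩
      simp only [B, hl, if_false, Set.mem_ofPred_eq, Set.mem_Icc]
      constructor <;> linarith
  have h1 : (stdNoise q).real (winSet a k) ≤ (stdNoise q).real (winSet b k)
      + (stdNoise q).real (⋃ l, B l) :=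
    (measureReal_mono hsub).trans (measureReal_union_le _ _)
  have h2 : (stdNoise q).real (⋃ l, B l) ≤ ∑ l, (stdNoise q).real (B l) :=
    measureReal_iUnion_fintype_le _
  have h3 : ∑ l, (stdNoise q).real (B l) ≤ ∑ _l : Fin (q + 1), 2 * d :=
    Finset.sum_le_sum fun l _ => hB l
  simp only [Finset.sum_const, Finset.card_univ, Fintype.card_fin, nsmul_eq_mul] at h3
  push_cast at h3
  linarith

lemma abs_selProb_sub_le {q : ℕ} {a b : Fin q → ℝ} {d : ℝ} (hd : 0 ≤ d)
    (h : ∀ l, |a l - b l| ≤ d) (k : Fin (q + 1)) :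
    |selProb a k - selProb b k| ≤ 2 * (q + 1) * d := by
  rw [abs_le]
  have h1 := selProb_sub_le hd h k
  have h2 := selProb_sub_le (a := b) (b := a) hd (fun l => by rw [abs_sub_comm]; exact h l) k
  constructor <;> linarith

lemma continuous_selProb {q : ℕ} (k : Fin (q + 1)) :
    Continuous (fun a : Fin q → ℝ => selProb a k) := by
  refine (LipschitzWith.of_dist_le_mul (K := 2 * (q + 1)) fun a b => ?_).continuous
  have := abs_selProb_sub_le (a := a) (b := b) dist_nonneg
    (fun l => (Real.dist_eq (a l) (b l)).symm.trans_le (dist_le_pi_dist a b l)) k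
  rw [Real.dist_eq]
  simpa using this

/-- Some category attains the maximal utility, and ties are null events: anti-concentration is
applied to intervals of length zero. -/
lemma sum_selProb {q : ℕ} (a : Fin q → ℝ) : ∑ k, selProb a k = 1 := by
  simp only [selProb_eq]
  have hdisj : Pairwise (Function.onFun Disjoint (winSet a)) := by
    intro k l hkl
    refine Set.disjoint_left.2 fun e hk hl => ?_
    have h1 := hk l hkl.symm
    have h2 := hl k hkl
    linarith
  have h1 := measureReal_iUnion_fintype (μ := stdNoise q) hdisj (measurableSet_winSet a)
  rw [← h1]
  let T : Fin (q + 1) × Fin (q + 1) → Set (Fin (q + 1) → ℝ) := fun p =>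
    if p.1 = p.2 then ∅ else {e | e p.1 - e p.2 ∈ Set.Icc (extPred a p.2 - extPred a p.1)
      (extPred a p.2 - extPred a p.1 + 0)}
  have hT : ∀ p, (stdNoise q).real (T p) = 0 := by
    intro p
    by_cases hp : p.1 = p.2
    · simp [T, hp]
    · simp only [T, hp, if_false]
      exact le_antisymm (stdNoise_sub_mem_Icc_le hp _ le_rfl) measureReal_nonneg
  have hcov : Set.univ ⊆ (⋃ k, winSet a k) ∪ ⋃ p, T p := by
    intro e _
    obtain ⟨k, -, hk⟩ := Finset.exists_max_image Finset.univ (fun k => extPred a k + e k)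
      Finset.univ_nonempty
    by_cases hw : e ∈ winSet a k
    · exact Or.inl (Set.mem_iUnion.2 ⟨k, hw⟩)
    · right
      simp only [winSet, Set.mem_ofPred_eq, not_forall, not_lt] at hw
      obtain ⟨l, hl, hle⟩ := hw
      have := hk l (Finset.mem_univ l)
      refine Set.mem_iUnion.2 ⟨(l, k), ?_⟩
      simp only [T, hl, if_false, Set.mem_ofPred_eq, Set.mem_Icc]
      constructor <;> linarith
  have h2 : (1 : ℝ) ≤ (stdNoise q).real (⋃ k, winSet a k) + (stdNoise q).real (⋃ p, T p) := by
    rw [← probReal_univ (μ := stdNoise q)]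
    exact (measureReal_mono hcov).trans (measureReal_union_le _ _)
  have h3 : (stdNoise q).real (⋃ p, T p) ≤ ∑ p, (stdNoise q).real (T p) :=
    measureReal_iUnion_fintype_le _
  simp only [hT, Finset.sum_const_zero] at h3
  exact le_antisymm measureReal_le_one (by linarith)

/-- The category probabilities are bounded away from zero on bounded sets of predictors. -/
lemma exists_pos_le_selProb (q : ℕ) (R : ℝ) :
    ∃ c > 0, ∀ a : Fin q → ℝ, (∀ l, |a l| ≤ R) → ∀ k, c ≤ selProb a k := by
  set R' := max R 0
  -- On this box the utility of `k` exceeds `-R' + 2R' = R'`, while every other utility is below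
  -- `R'`; hence `k` wins whatever the predictor is.
  let box : Fin (q + 1) → Fin (q + 1) → Set ℝ := fun k l =>
    if l = k then Set.Ioi (2 * R') else Set.Iio 0
  have hbox : ∀ k, 0 < (stdNoise q).real (Set.univ.pi (box k)) := by
    intro k
    rw [measureReal_def, ENNReal.toReal_pos_iff]
    refine ⟨?_, measure_lt_top _ _⟩
    rw [stdNoise, Measure.pi_pi, pos_iff_ne_zero]
    refine Finset.prod_ne_zero_iff.2 fun l _ h0 => ?_
    have h1 := gaussianReal_absolutelyContinuous' 0 one_ne_zero h0
    by_cases hl : l = k <;> simp [box, hl] at h1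
  obtain ⟨k₀, -, hk₀⟩ := Finset.exists_min_image Finset.univ
    (fun k => (stdNoise q).real (Set.univ.pi (box k))) Finset.univ_nonempty
  refine ⟨_, hbox k₀, fun a ha k => (hk₀ k (Finset.mem_univ k)).trans ?_⟩
  rw [selProb_eq]
  refine measureReal_mono fun e he l hl => ?_
  have ha' : ∀ l, |a l| ≤ R' := fun l => (ha l).trans (le_max_left _ _)
  have h1 := abs_le.1 (extPred_le (le_max_right _ _) ha' l)
  have h2 := abs_le.1 (extPred_le (le_max_right _ _) ha' k)
  have h3 := he l (Set.mem_univ l)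
  have h4 := he k (Set.mem_univ k)
  simp only [box, hl, if_false, Set.mem_Iio] at h3
  simp only [box, if_true, Set.mem_Ioi] at h4
  linarith

lemma selProb_pos {q : ℕ} (a : Fin q → ℝ) (k : Fin (q + 1)) : 0 < selProb a k := by
  obtain ⟨c, hc, h⟩ := exists_pos_le_selProb q (∑ l, |a l|)
  exact hc.trans_le (h a (fun l => Finset.single_le_sum (f := fun l => |a l|)
    (fun _ _ => abs_nonneg _) (Finset.mem_univ l)) k)

/-! ### The linear predictor -/

/-- `β` is measurable on `[0,1]` and bounded there by `B`. -/
def BddCoef (β : ℝ → ℝ) (B : ℝ) : Prop :=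
  AEStronglyMeasurable β (volume.restrict (Set.Icc (0 : ℝ) 1)) ∧
    ∀ t ∈ Set.Icc (0 : ℝ) 1, |β t| ≤ B

lemma ae_restrict_Icc {p : ℝ → Prop} (h : ∀ t ∈ Set.Icc (0 : ℝ) 1, p t) :
    ∀ᵐ t ∂(volume.restrict (Set.Icc (0 : ℝ) 1)), p t :=
  (ae_restrict_iff' measurableSet_Icc).2 (ae_of_all _ h)

lemma BddCoef.integrable_mul {β : ℝ → ℝ} {B : ℝ} (h : BddCoef β B) (x : Curve) :
    Integrable (fun t => β t * x t) (volume.restrict (Set.Icc (0 : ℝ) 1)) :=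
  (L1.integrable_coeFn x).bdd_mul h.1 (ae_restrict_Icc h.2)

lemma BddCoef.abs_linPred_le {β : ℝ → ℝ} {B : ℝ} (h : BddCoef β B) (x : Curve) :
    |linPred β x| ≤ B * ‖x‖ := by
  rw [L1.norm_eq_integral_norm, ← integral_const_mul, linPred, ← Real.norm_eq_abs]
  refine norm_integral_le_of_norm_le ((L1.integrable_coeFn x).norm.const_mul B) ?_
  filter_upwards [ae_restrict_Icc h.2] with t ht
  rw [norm_mul]
  exact mul_le_mul_of_nonneg_right ht (norm_nonneg _)

lemma BddCoef.sub {β β' : ℝ → ℝ} {B B' d : ℝ} (h : BddCoef β B) (h' : BddCoef β' B')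
    (hd : ∀ t ∈ Set.Icc (0 : ℝ) 1, |β t - β' t| ≤ d) : BddCoef (fun t => β t - β' t) d :=
  ⟨h.1.sub h'.1, hd⟩

lemma BddCoef.abs_linPred_sub_le {β β' : ℝ → ℝ} {B B' d : ℝ} (h : BddCoef β B)
    (h' : BddCoef β' B') (hd : ∀ t ∈ Set.Icc (0 : ℝ) 1, |β t - β' t| ≤ d) (x : Curve) :
    |linPred β x - linPred β' x| ≤ d * ‖x‖ := by
  have : linPred β x - linPred β' x = linPred (fun t => β t - β' t) x := by
    simp only [linPred, sub_mul]
    rw [integral_sub (h.integrable_mul x) (h'.integrable_mul x)]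
  rw [this]
  exact (h.sub h' hd).abs_linPred_le x

lemma BddCoef.continuous_linPred {β : ℝ → ℝ} {B : ℝ} (h : BddCoef β B) :
    Continuous (linPred β) := by
  refine (LipschitzWith.of_dist_le_mul (K := B.toNNReal) fun x y => ?_).continuous
  have : linPred β x - linPred β y = linPred β (x - y) := by
    simp only [linPred]
    rw [← integral_sub (h.integrable_mul x) (h.integrable_mul y)]
    refine integral_congr_ae ?_
    filter_upwards [Lp.coeFn_sub x y] with t ht
    rw [ht, Pi.sub_apply, mul_sub]
  rw [Real.dist_eq, this, dist_eq_norm]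
  exact (h.abs_linPred_le _).trans
    (mul_le_mul_of_nonneg_right (Real.le_coe_toNNReal B) (norm_nonneg _))

lemma catProb_eq {q : ℕ} (β : Fin q → ℝ → ℝ) (x : Curve) (k : Fin (q + 1)) :
    catProb β x k = selProb (fun l => linPred (β l) x) k := rfl

lemma measurable_selProb {q : ℕ} :
    Measurable (fun z : (Fin q → ℝ) × Fin (q + 1) => selProb z.1 z.2) :=
  measurable_from_prod_countable_left fun k => (continuous_selProb k).measurable

/-- A stable basis, with the constant of stability made explicit and `J = 0` included. -/
structure StableBasis (ψ : (J : ℕ) → Fin J → ℝ → ℝ) (C K₀ : ℝ) : Prop where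
  pos : 0 < C
  meas : ∀ J j, Measurable (ψ J j)
  stable : ∀ J, ∀ θ₁ θ₂ : Fin J → ℝ, ∀ t ∈ Set.Icc (0 : ℝ) 1,
    |series ψ θ₁ t - series ψ θ₂ t| ≤ C * (J : ℝ) ^ K₀ * Real.sqrt (∑ j, (θ₁ j - θ₂ j) ^ 2)

lemma BasisStable.exists_stableBasis {ψ : (J : ℕ) → Fin J → ℝ → ℝ} {K₀ : ℝ}
    (h : BasisStable ψ K₀) (hψ : ∀ J j, Measurable (ψ J j)) : ∃ C, StableBasis ψ C K₀ := by
  obtain ⟨C, hC, h⟩ := h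
  refine ⟨C, hC, hψ, fun J θ₁ θ₂ t ht => ?_⟩
  rcases Nat.eq_zero_or_pos J with rfl | hJ
  · simp [series]
  · exact h J hJ θ₁ θ₂ t ht

section

variable {ψ : (J : ℕ) → Fin J → ℝ → ℝ} {C K₀ : ℝ}

lemma StableBasis.bddCoef_series (h : StableBasis ψ C K₀) {J : ℕ} (θ : Fin J → ℝ) :
    BddCoef (series ψ θ) (C * (J : ℝ) ^ K₀ * Real.sqrt (∑ j, θ j ^ 2)) := by
  constructor
  · have : Measurable (series ψ θ) :=
      Finset.measurable_fun_sum _ fun j _ => (h.meas J j).const_mul _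
    exact this.aestronglyMeasurable
  · intro t ht
    simpa [series] using h.stable J θ 0 t ht

lemma StableBasis.bddCoef_basis (h : StableBasis ψ C K₀) (J : ℕ) (j : Fin J) :
    BddCoef (ψ J j) (C * (J : ℝ) ^ K₀) := by
  have h1 := h.bddCoef_series (Pi.single j (1 : ℝ))
  have h2 : series ψ (Pi.single j (1 : ℝ)) = ψ J j := by
    ext t
    simp [series, Pi.single_apply]
  have h3 : ∑ i, (Pi.single j (1 : ℝ) : Fin J → ℝ) i ^ 2 = 1 := by
    simp [Pi.single_apply]
  rw [h2, h3] at h1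
  simpa using h1

/-- Makes the predictor a finite sum of products of coordinates of `θ` and continuous functions of
`x`, whence joint measurability in parameter and data, which Tonelli's theorem requires. -/
lemma StableBasis.linPred_series (h : StableBasis ψ C K₀) {J : ℕ} (θ : Fin J → ℝ) (x : Curve) :
    linPred (series ψ θ) x = ∑ j, θ j * linPred (ψ J j) x := by
  simp only [linPred, series, Finset.sum_mul, mul_assoc]
  rw [integral_finsetSum _ fun j _ => ((h.bddCoef_basis J j).integrable_mul x).const_mul _]
  exact Finset.sum_congr rfl fun j _ => integral_const_mul _ _

lemma StableBasis.measurable_catProb_series (h : StableBasis ψ C K₀) {q : ℕ} (J : ℕ) :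
    Measurable (fun z : (Fin q → Fin J → ℝ) × (Curve × Fin (q + 1)) =>
      catProb (coefFun ψ ⟨J, z.1⟩) z.2.1 z.2.2) := by
  simp only [catProb_eq]
  have h1 : Measurable (fun z : (Fin q → Fin J → ℝ) × (Curve × Fin (q + 1)) =>
      fun l => linPred (coefFun ψ ⟨J, z.1⟩ l) z.2.1) := by
    refine measurable_pi_lambda _ fun l => ?_
    simp only [coefFun, h.linPred_series]
    refine Finset.measurable_fun_sum _ fun j _ => Measurable.mul (by fun_prop) ?_
    exact (h.bddCoef_basis J j).continuous_linPred.measurable.comp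
      (measurable_fst.comp measurable_snd)
  exact measurable_selProb.comp (h1.prodMk (measurable_snd.comp measurable_snd))

lemma measurable_catProb {q : ℕ} {β : Fin q → ℝ → ℝ} {B : Fin q → ℝ}
    (h : ∀ l, BddCoef (β l) (B l)) :
    Measurable (fun z : Curve × Fin (q + 1) => catProb β z.1 z.2) := by
  simp only [catProb_eq]
  have h1 : Measurable (fun z : Curve × Fin (q + 1) => fun l => linPred (β l) z.1) :=
    measurable_pi_lambda _ fun l => (h l).continuous_linPred.measurable.comp measurable_fst
  exact measurable_selProb.comp (h1.prodMk measurable_snd)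

/-- A function that is uniformly approximated by a stable basis is measurable and bounded. -/
lemma BasisApprox.exists_bddCoef {β : ℝ → ℝ} {α H : ℝ} (hα : 0 < α)
    (ha : BasisApprox ψ β α H) (h : StableBasis ψ C K₀) : ∃ B, BddCoef β B := by
  obtain ⟨D, hD, ha⟩ := ha
  choose θ hθ hθ' using fun n : ℕ => ha (n + 1) (Nat.le_add_left 1 n)
  refine ⟨D * ((0 + 1 : ℕ) : ℝ) ^ (-α)
    + C * ((0 + 1 : ℕ) : ℝ) ^ K₀ * Real.sqrt (∑ j, θ 0 j ^ 2), ?_, fun t ht => ?_⟩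
  rotate_left
  · have h1 := hθ' 0 t ht
    have h2 := (h.bddCoef_series (θ 0)).2 t ht
    calc |β t| = |(β t - series ψ (θ 0) t) + series ψ (θ 0) t| := by ring_nf
      _ ≤ _ := (abs_add_le _ _).trans (add_le_add h1 h2)
  · refine aestronglyMeasurable_of_tendsto_ae atTop (fun n => (h.bddCoef_series (θ n)).1) ?_
    refine ae_restrict_Icc fun t ht => ?_
    rw [tendsto_iff_dist_tendsto_zero]
    have h0 : Tendsto (fun n : ℕ => D * ((n + 1 : ℕ) : ℝ) ^ (-α)) atTop (𝓝 (D * 0)) :=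
      ((tendsto_rpow_neg_atTop hα).comp
        (tendsto_natCast_atTop_atTop.comp (tendsto_add_atTop_nat 1))).const_mul D
    rw [mul_zero] at h0
    refine squeeze_zero (fun _ => dist_nonneg) (fun n => ?_) h0
    rw [dist_comm, Real.dist_eq]
    exact hθ' n t ht

end

/-- Category probabilities are Lipschitz in the coefficient functions. -/
lemma abs_catProb_sub_le {q : ℕ} {β β' : Fin q → ℝ → ℝ} {B B' : Fin q → ℝ} {d R : ℝ}
    (hd0 : 0 ≤ d) (h : ∀ l, BddCoef (β l) (B l)) (h' : ∀ l, BddCoef (β' l) (B' l))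
    (hd : ∀ l, ∀ t ∈ Set.Icc (0 : ℝ) 1, |β l t - β' l t| ≤ d) {x : Curve} (hx : ‖x‖ ≤ R)
    (k : Fin (q + 1)) : |catProb β x k - catProb β' x k| ≤ 2 * (q + 1) * R * d := by
  have hR : 0 ≤ R := (norm_nonneg x).trans hx
  have := abs_selProb_sub_le (a := fun l => linPred (β l) x) (b := fun l => linPred (β' l) x)
    (d := d * R) (by positivity) (fun l =>
      ((h l).abs_linPred_sub_le (h' l) (hd l) x).trans (by gcongr)) k
  calc _ ≤ _ := this
    _ = _ := by ring

lemma catProb_nonneg {q : ℕ} (β : Fin q → ℝ → ℝ) (x : Curve) (k : Fin (q + 1)) :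
    0 ≤ catProb β x k := measureReal_nonneg

lemma catProb_le_one {q : ℕ} (β : Fin q → ℝ → ℝ) (x : Curve) (k : Fin (q + 1)) :
    catProb β x k ≤ 1 := selProb_le_one _ k

lemma catProb_pos {q : ℕ} (β : Fin q → ℝ → ℝ) (x : Curve) (k : Fin (q + 1)) :
    0 < catProb β x k := selProb_pos _ k

lemma sum_catProb {q : ℕ} (β : Fin q → ℝ → ℝ) (x : Curve) : ∑ k, catProb β x k = 1 :=
  sum_selProb _

open scoped ENNReal

/-! ### Markov bounds for likelihood ratios of i.i.d. observations -/

section Markov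

variable {Z : Type*} [MeasurableSpace Z] {P : Measure Z} [IsProbabilityMeasure P] {n : ℕ}

lemma lintegral_pi_prod {g : Z → ℝ≥0∞} (hg : Measurable g) :
    ∫⁻ D, ∏ i, g (D i) ∂(Measure.pi fun _ : Fin n => P) = (∫⁻ z, g z ∂P) ^ n := by
  have hi : iIndepFun (fun (i : Fin n) (D : Fin n → Z) => g (D i))
      (Measure.pi fun _ : Fin n => P) :=
    iIndepFun_pi (X := fun _ z => g z) (fun _ => hg.aemeasurable)
  have h := lintegral_prod_eq_prod_lintegral_of_indepFun Finset.univ _ hi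
    (fun i => hg.comp (measurable_pi_apply i))
  rw [h]
  have h2 : ∀ i : Fin n, ∫⁻ D, g (D i) ∂(Measure.pi fun _ : Fin n => P) = ∫⁻ z, g z ∂P := fun i =>
    (measurePreserving_eval (fun _ : Fin n => P) i).lintegral_comp hg
  simp [h2]

lemma measure_le_prod_le {g : Z → ℝ≥0∞} (hg : Measurable g) {κ A : ℝ≥0∞} (hκ : κ ≠ 0)
    (hκ' : κ ≠ ∞) (hA : ∫⁻ z, g z ∂P ≤ A) :
    (Measure.pi fun _ : Fin n => P) {D | κ ≤ ∏ i, g (D i)} ≤ A ^ n / κ := by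
  have hm : Measurable fun D : Fin n → Z => ∏ i, g (D i) :=
    Finset.measurable_fun_prod _ fun i _ => hg.comp (measurable_pi_apply i)
  refine (meas_ge_le_lintegral_div hm.aemeasurable hκ hκ').trans ?_
  rw [lintegral_pi_prod hg]
  gcongr

lemma measurable_prod_ratio {Ω : Type*} [MeasurableSpace Ω] {r : Ω → Z → ℝ≥0∞}
    (hr : Measurable (Function.uncurry r)) :
    Measurable (fun z : (Fin n → Z) × Ω => ∏ i, r z.2 (z.1 i)) := by
  refine Finset.measurable_fun_prod _ fun i _ => ?_
  exact hr.comp (measurable_snd.prodMk ((measurable_pi_apply i).comp measurable_fst))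

lemma lintegral_lintegral_prod_le {Ω : Type*} [MeasurableSpace Ω] {ν : Measure Ω} [SFinite ν]
    {r : Ω → Z → ℝ≥0∞} (hr : Measurable (Function.uncurry r)) {A : ℝ≥0∞}
    (hA : ∀ᵐ θ ∂ν, ∫⁻ z, r θ z ∂P ≤ A) :
    ∫⁻ D, ∫⁻ θ, ∏ i, r θ (D i) ∂ν ∂(Measure.pi fun _ : Fin n => P) ≤ A ^ n * ν Set.univ := by
  rw [lintegral_lintegral_swap (measurable_prod_ratio hr).aemeasurable]
  calc _ ≤ ∫⁻ _, A ^ n ∂ν := by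
        refine lintegral_mono_ae ?_
        filter_upwards [hA] with θ hθ
        have hθm : Measurable (r θ) := hr.comp measurable_prodMk_left
        rw [lintegral_pi_prod hθm]
        gcongr
    _ = _ := by simp

/-- The difference of the two sides is `(x - y)² / x`. With `y = κ⁻¹` and `x` a likelihood ratio, it
says that the ratio and its inverse cannot both be small. -/
lemma two_mul_le_add_sq_mul_inv {x y : ℝ≥0∞} (hx0 : x ≠ 0) (hx : x ≠ ∞) (hy : y ≠ ∞) :
    2 * y ≤ x + y ^ 2 * x⁻¹ := by
  lift x to NNReal using hx
  lift y to NNReal using hy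
  have hx0' : x ≠ 0 := by simpa using hx0
  rw [← ENNReal.coe_inv hx0']
  norm_cast
  rw [← NNReal.coe_le_coe]
  push_cast
  have hx1 : (0 : ℝ) < x := NNReal.coe_pos.2 (pos_iff_ne_zero.2 hx0')
  rw [← sub_nonneg]
  have : (x : ℝ) + y ^ 2 * (x : ℝ)⁻¹ - 2 * y = (x - y) ^ 2 * (x : ℝ)⁻¹ := by
    field_simp
    ring
  rw [this]
  positivity

/-- A lower bound for integrated likelihood ratios: it is enough to control the mean of the inverse
likelihood ratio of one observation. -/
lemma measure_evidence_lt_le {Ω : Type*} [MeasurableSpace Ω] {ν : Measure Ω} [IsFiniteMeasure ν]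
    {r : Ω → Z → ℝ≥0∞} (hr : Measurable (Function.uncurry r)) (hr0 : ∀ θ z, r θ z ≠ 0)
    (hr1 : ∀ θ z, r θ z ≠ ∞) {A : ℝ≥0∞} (hA : ∀ᵐ θ ∂ν, ∫⁻ z, (r θ z)⁻¹ ∂P ≤ A)
    {κ : ℝ≥0∞} (hκ : κ ≠ 0) (hκ' : κ ≠ ∞) :
    (Measure.pi fun _ : Fin n => P) {D | ∫⁻ θ, ∏ i, r θ (D i) ∂ν < κ⁻¹ * ν Set.univ}
      ≤ A ^ n / κ := by
  rcases eq_or_ne (ν Set.univ) 0 with h0 | h0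
  · simp [h0]
  have hν : ν Set.univ ≠ ∞ := measure_ne_top _ _
  have hmi : Measurable (Function.uncurry fun θ z => (r θ z)⁻¹) := hr.inv
  have hmi' := measurable_prod_ratio (n := n) hmi
  have hκi : κ⁻¹ ≠ ∞ := ENNReal.inv_ne_top.2 hκ
  -- If the ratios integrated to less than `κ⁻¹ ν(univ)` and their inverses to less than `κ
  -- ν(univ)`, integrating `2κ⁻¹ ≤ x + κ⁻² x⁻¹` would give a contradiction. Only the integral of the
  -- inverses then has to be controlled, by Tonelli and Markov.
  have hsub : {D : Fin n → Z | ∫⁻ θ, ∏ i, r θ (D i) ∂ν < κ⁻¹ * ν Set.univ} ⊆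
      {D | κ * ν Set.univ ≤ ∫⁻ θ, ∏ i, (r θ (D i))⁻¹ ∂ν} := by
    intro D hD
    simp only [Set.mem_ofPred_eq] at hD ⊢
    by_contra! hlt
    have h1 : ∫⁻ _, 2 * κ⁻¹ ∂ν ≤
        ∫⁻ θ, (∏ i, r θ (D i) + (κ⁻¹) ^ 2 * ∏ i, (r θ (D i))⁻¹) ∂ν := by
      refine lintegral_mono fun θ => ?_
      have h2 : ∏ i, (r θ (D i))⁻¹ = (∏ i, r θ (D i))⁻¹ :=
        (ENNReal.prod_inv_distrib fun i _ j _ _ => Or.inl (hr0 _ _)).symm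
      rw [h2]
      exact two_mul_le_add_sq_mul_inv (Finset.prod_ne_zero_iff.2 fun i _ => hr0 _ _)
        (ENNReal.prod_ne_top fun i _ => hr1 _ _) hκi
    have hmD : Measurable fun θ => ∏ i, r θ (D i) :=
      Finset.measurable_fun_prod _ fun i _ => hr.of_uncurry_right
    have hmiD : Measurable fun θ => ∏ i, (r θ (D i))⁻¹ :=
      Finset.measurable_fun_prod _ fun i _ => (hr.of_uncurry_right (y := D i)).inv
    rw [lintegral_add_left hmD, lintegral_const_mul _ hmiD, lintegral_const] at h1
    have h3 : (κ⁻¹) ^ 2 * ∫⁻ θ, ∏ i, (r θ (D i))⁻¹ ∂ν ≤ κ⁻¹ * ν Set.univ := by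
      calc _ ≤ (κ⁻¹) ^ 2 * (κ * ν Set.univ) := by gcongr
        _ = κ⁻¹ * (κ⁻¹ * κ) * ν Set.univ := by ring
        _ = _ := by rw [ENNReal.inv_mul_cancel hκ hκ', mul_one]
    have h4 : κ⁻¹ * ν Set.univ + κ⁻¹ * ν Set.univ ≤
        ∫⁻ θ, ∏ i, r θ (D i) ∂ν + κ⁻¹ * ν Set.univ := by
      calc _ = 2 * κ⁻¹ * ν Set.univ := by ring
        _ ≤ _ := h1.trans (by gcongr)
    exact absurd hD (not_lt.2 ((ENNReal.add_le_add_iff_right (ENNReal.mul_ne_top hκi hν)).1 h4))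
  refine (measure_mono hsub).trans ?_
  refine (meas_ge_le_lintegral_div (Measurable.lintegral_prod_right' hmi').aemeasurable
    (mul_ne_zero hκ h0) (ENNReal.mul_ne_top hκ' hν)).trans ?_
  calc _ ≤ A ^ n * ν Set.univ / (κ * ν Set.univ) := by
        gcongr
        exact lintegral_lintegral_prod_le hmi hA
    _ = _ := ENNReal.mul_div_mul_right _ _ h0 hν

/-- Markov and Tonelli on each dimension separately, since the parameter space is a disjoint union
over `J`. -/
lemma measure_le_tsum_lintegral_le {Ω : ℕ → Type*} [∀ J, MeasurableSpace (Ω J)]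
    {ν : (J : ℕ) → Measure (Ω J)} [∀ J, SFinite (ν J)] {r : (J : ℕ) → Ω J → Z → ℝ≥0∞}
    (hr : ∀ J, Measurable (Function.uncurry (r J)))
    (hA : ∀ J θ, ∫⁻ z, r J θ z ∂P ≤ 1) {κ : ℝ≥0∞} (hκ : κ ≠ 0) (hκ' : κ ≠ ∞) :
    (Measure.pi fun _ : Fin n => P) {D | κ ≤ ∑' J, ∫⁻ θ, ∏ i, r J θ (D i) ∂(ν J)}
      ≤ (∑' J, ν J Set.univ) / κ := by
  have hm : ∀ J, Measurable fun D : Fin n → Z => ∫⁻ θ, ∏ i, r J θ (D i) ∂(ν J) := fun J =>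
    Measurable.lintegral_prod_right' (measurable_prod_ratio (hr J))
  refine (meas_ge_le_lintegral_div (Measurable.tsum hm).aemeasurable hκ hκ').trans ?_
  rw [lintegral_tsum fun J => (hm J).aemeasurable]
  gcongr with J
  refine (lintegral_lintegral_prod_le (hr J) (ae_of_all _ (hA J))).trans ?_
  simp

end Markov

/-! ### Integrals with respect to the law of one observation -/

section Observation

variable {q : ℕ} {G : Measure Curve} {β β₀ : Fin q → ℝ → ℝ}
  {B B₀ : Fin q → ℝ}

lemma lintegral_obsLaw [SFinite G] (h₀ : ∀ l, BddCoef (β₀ l) (B₀ l))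
    {g : Curve × Fin (q + 1) → ℝ≥0∞}
    (hg : Measurable g) :
    ∫⁻ z, g z ∂(obsLaw G β₀) =
      ∫⁻ x, ∑ k, ENNReal.ofReal (catProb β₀ x k) * g (x, k) ∂G := by
  have hm := (measurable_catProb h₀).ennreal_ofReal
  rw [obsLaw, lintegral_withDensity_eq_lintegral_mul _ hm hg,
    lintegral_prod _ (hm.mul hg).aemeasurable]
  simp only [Pi.mul_apply, lintegral_count, tsum_fintype]

lemma isProbabilityMeasure_obsLaw [IsProbabilityMeasure G] (h₀ : ∀ l, BddCoef (β₀ l) (B₀ l)) :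
    IsProbabilityMeasure (obsLaw G β₀) := by
  constructor
  rw [← lintegral_one, lintegral_obsLaw h₀ measurable_const]
  simp only [mul_one]
  have : ∀ x, ∑ k, ENNReal.ofReal (catProb β₀ x k) = 1 := fun x => by
    rw [← ENNReal.ofReal_sum_of_nonneg fun k _ => catProb_nonneg _ _ _, sum_catProb,
      ENNReal.ofReal_one]
  simp [this]

/-- The likelihood ratio of one observation. -/
noncomputable def ratio (β β₀ : Fin q → ℝ → ℝ) (z : Curve × Fin (q + 1)) : ℝ≥0∞ :=
  ENNReal.ofReal (catProb β z.1 z.2 / catProb β₀ z.1 z.2)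

lemma measurable_ratio (h : ∀ l, BddCoef (β l) (B l)) (h₀ : ∀ l, BddCoef (β₀ l) (B₀ l)) :
    Measurable (ratio β β₀) :=
  ((measurable_catProb h).div (measurable_catProb h₀)).ennreal_ofReal

lemma lintegral_ratio [IsProbabilityMeasure G]
    (h : ∀ l, BddCoef (β l) (B l)) (h₀ : ∀ l, BddCoef (β₀ l) (B₀ l)) :
    ∫⁻ z, ratio β β₀ z ∂(obsLaw G β₀) = 1 := by
  rw [lintegral_obsLaw h₀ (measurable_ratio h h₀)]
  have : ∀ x, ∑ k, ENNReal.ofReal (catProb β₀ x k) * ratio β β₀ (x, k) = 1 := fun x => by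
    have h1 : ∀ k, ENNReal.ofReal (catProb β₀ x k) * ratio β β₀ (x, k)
        = ENNReal.ofReal (catProb β x k) := fun k => by
      rw [ratio, ← ENNReal.ofReal_mul (catProb_nonneg _ _ _),
        mul_div_cancel₀ _ (catProb_pos β₀ x k).ne']
    simp only [h1]
    rw [← ENNReal.ofReal_sum_of_nonneg fun k _ => catProb_nonneg _ _ _, sum_catProb,
      ENNReal.ofReal_one]
  simp [this]

/-- A chi-square bound. -/
lemma lintegral_inv_ratio_le [IsProbabilityMeasure G]
    (h : ∀ l, BddCoef (β l) (B l)) (h₀ : ∀ l, BddCoef (β₀ l) (B₀ l))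
    {c d : ℝ} (hc : 0 < c) (hcb : ∀ᵐ x ∂G, ∀ k, c ≤ catProb β x k)
    (hd : ∀ᵐ x ∂G, ∀ k, |catProb β x k - catProb β₀ x k| ≤ d) :
    ∫⁻ z, (ratio β β₀ z)⁻¹ ∂(obsLaw G β₀) ≤
      ENNReal.ofReal (Real.exp ((q + 1) * d ^ 2 / c)) := by
  have hmr : Measurable fun z => (ratio β β₀ z)⁻¹ := (measurable_ratio h h₀).inv
  rw [lintegral_obsLaw h₀ hmr]
  calc _ ≤ ∫⁻ _, ENNReal.ofReal (Real.exp ((q + 1) * d ^ 2 / c)) ∂G := by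
        refine lintegral_mono_ae ?_
        filter_upwards [hcb, hd] with x hx1 hx2
        have h1 : ∀ k, ENNReal.ofReal (catProb β₀ x k) * (ratio β β₀ (x, k))⁻¹
            = ENNReal.ofReal (catProb β₀ x k * (catProb β x k / catProb β₀ x k)⁻¹) := fun k => by
          rw [ratio, ← ENNReal.ofReal_inv_of_pos (div_pos (catProb_pos _ _ _) (catProb_pos _ _ _)),
            ← ENNReal.ofReal_mul (catProb_nonneg _ _ _)]
        simp only [h1]
        rw [← ENNReal.ofReal_sum_of_nonneg fun k _ => mul_nonneg (catProb_nonneg _ _ _)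
          (inv_nonneg.2 (div_nonneg (catProb_nonneg _ _ _) (catProb_nonneg _ _ _)))]
        refine ENNReal.ofReal_le_ofReal ?_
        have h2 : ∀ k, catProb β₀ x k * (catProb β x k / catProb β₀ x k)⁻¹ ≤
            2 * catProb β₀ x k - catProb β x k + d ^ 2 / c := fun k => by
          have hp := catProb_pos β x k
          have hp0 := catProb_pos β₀ x k
          -- The identity `p₀²/p = 2p₀ - p + (p - p₀)²/p`; the linear terms sum to `1` over the
          -- categories.
          have h3 : catProb β₀ x k * (catProb β x k / catProb β₀ x k)⁻¹ =
            2 * catProb β₀ x k - catProb β x k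
              + (catProb β x k - catProb β₀ x k) ^ 2 / catProb β x k := by
            field_simp
            ring
          rw [h3]
          have h4 : (catProb β x k - catProb β₀ x k) ^ 2 ≤ d ^ 2 :=
            sq_le_sq.2 ((hx2 k).trans (le_abs_self d))
          have := div_le_div₀ (sq_nonneg d) h4 hc (hx1 k)
          linarith
        refine (Finset.sum_le_sum fun k _ => h2 k).trans ?_
        rw [Finset.sum_add_distrib, Finset.sum_sub_distrib, ← Finset.mul_sum, sum_catProb,
          sum_catProb]
        simp only [Finset.sum_const, Finset.card_univ, Fintype.card_fin, nsmul_eq_mul]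
        have := Real.add_one_le_exp ((q + 1) * d ^ 2 / c)
        push_cast
        rw [mul_div_assoc] at this ⊢
        linarith
    _ = _ := by simp

/-- `√(ab) = (a+b)/2 - (√a-√b)²/2`, and `|a-b| = |√a-√b| (√a+√b) ≤ 2|√a-√b|` on `[0,1]`. This
converts Hellinger affinity into the `L²` distance. -/
lemma sqrt_mul_le_of_le_one {a b : ℝ} (ha : 0 ≤ a) (ha1 : a ≤ 1) (hb : 0 ≤ b) (hb1 : b ≤ 1) :
    √(a * b) ≤ (a + b) / 2 - |a - b| ^ 2 / 8 := by
  have h1 : √a ≤ 1 := Real.sqrt_le_one.2 ha1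
  have h2 : √b ≤ 1 := Real.sqrt_le_one.2 hb1
  have h3 := Real.sqrt_nonneg a
  have h4 := Real.sqrt_nonneg b
  rw [Real.sqrt_mul ha]
  have h5 : a = √a ^ 2 := (Real.sq_sqrt ha).symm
  have h6 : b = √b ^ 2 := (Real.sq_sqrt hb).symm
  have h7 : |a - b| ^ 2 = (√a - √b) ^ 2 * (√a + √b) ^ 2 := by
    rw [sq_abs]
    conv_lhs => rw [h5, h6]
    ring
  have h8 : (√a + √b) ^ 2 ≤ 4 := by nlinarith
  have h9 := mul_le_mul_of_nonneg_left h8 (sq_nonneg (√a - √b))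
  rw [h7]
  nlinarith

lemma catDist_sq (β β₀ : Fin q → ℝ → ℝ) :
    catDist G β β₀ ^ 2 = ∑ k, ∫ x, |catProb β x k - catProb β₀ x k| ^ 2 ∂G :=
  Real.sq_sqrt (Finset.sum_nonneg fun _ _ => integral_nonneg fun _ => by positivity)

lemma measurable_catProb_left (h : ∀ l, BddCoef (β l) (B l)) (k : Fin (q + 1)) :
    Measurable fun x => catProb β x k :=
  (continuous_selProb k).measurable.comp (measurable_pi_lambda _ fun l =>
    (h l).continuous_linPred.measurable)

/-- A bound for the affinity between the true density and an upper bracket. -/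
lemma lintegral_sqrt_bracket_le [IsProbabilityMeasure G]
    (h : ∀ l, BddCoef (β l) (B l)) (h₀ : ∀ l, BddCoef (β₀ l) (B₀ l))
    {δ : ℝ} (hδ : 0 ≤ δ) :
    ∫⁻ z, ENNReal.ofReal √((catProb β z.1 z.2 + δ) / catProb β₀ z.1 z.2) ∂(obsLaw G β₀) ≤
      ENNReal.ofReal (Real.exp (-(catDist G β β₀ ^ 2 / 8) + (q + 1) * √δ)) := by
  have hm : ∀ k, Measurable fun x => |catProb β x k - catProb β₀ x k| ^ 2 := fun k => by
    have h1 := measurable_catProb_left h k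
    have h2 := measurable_catProb_left h₀ k
    have h3 : (fun x => |catProb β x k - catProb β₀ x k| ^ 2) =
        fun x => (catProb β x k - catProb β₀ x k) ^ 2 := by
      ext x
      rw [sq_abs]
    rw [h3]
    exact (h1.sub h2).pow_const 2
  have hle : ∀ x k, |catProb β x k - catProb β₀ x k| ^ 2 ≤ 1 := fun x k => by
    refine pow_le_one₀ (abs_nonneg _) (abs_le.2 ⟨?_, ?_⟩) <;>
      linarith [catProb_nonneg β x k, catProb_le_one β x k, catProb_nonneg β₀ x k,
        catProb_le_one β₀ x k]
  have hint : ∀ k, Integrable (fun x => |catProb β x k - catProb β₀ x k| ^ 2) G := fun k =>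
    Integrable.of_bound (hm k).aestronglyMeasurable 1 (ae_of_all _ fun x => by
      rw [Real.norm_of_nonneg (by positivity)]
      exact hle x k)
  have hmg : Measurable fun z : Curve × Fin (q + 1) =>
      ENNReal.ofReal √((catProb β z.1 z.2 + δ) / catProb β₀ z.1 z.2) :=
    (((measurable_catProb h).add_const δ).div (measurable_catProb h₀)).sqrt.ennreal_ofReal
  rw [lintegral_obsLaw h₀ hmg]
  have hpt : ∀ x, ∑ k, ENNReal.ofReal (catProb β₀ x k) *
      ENNReal.ofReal √((catProb β x k + δ) / catProb β₀ x k) ≤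
      ENNReal.ofReal (1 + (q + 1) * √δ - (∑ k, |catProb β x k - catProb β₀ x k| ^ 2) / 8) := by
    intro x
    simp only [← ENNReal.ofReal_mul (catProb_nonneg β₀ x _)]
    rw [← ENNReal.ofReal_sum_of_nonneg fun k _ => mul_nonneg (catProb_nonneg _ _ _)
      (Real.sqrt_nonneg _)]
    refine ENNReal.ofReal_le_ofReal ?_
    have hk : ∀ k, catProb β₀ x k * √((catProb β x k + δ) / catProb β₀ x k) ≤
        (catProb β x k + catProb β₀ x k) / 2 - |catProb β x k - catProb β₀ x k| ^ 2 / 8 + √δ := by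
      intro k
      have hp := catProb_nonneg β x k
      have hp0 := catProb_pos β₀ x k
      have h1 : catProb β₀ x k * √((catProb β x k + δ) / catProb β₀ x k) =
          √((catProb β x k + δ) * catProb β₀ x k) := by
        rw [← Real.sqrt_sq hp0.le, ← Real.sqrt_mul (sq_nonneg _), Real.sqrt_sq hp0.le]
        congr 1
        field_simp
      have h2 : √((catProb β x k + δ) * catProb β₀ x k) ≤
          √(catProb β x k * catProb β₀ x k) + √δ := by
        -- As `p₀ ≤ 1`, enlarging `p` by `δ` costs at most `√δ` in the affinity, without any lower
        -- bound on `p`.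
        have h3 : (catProb β x k + δ) * catProb β₀ x k ≤ catProb β x k * catProb β₀ x k + δ := by
          nlinarith [catProb_le_one β₀ x k]
        refine (Real.sqrt_le_sqrt h3).trans ?_
        rw [Real.sqrt_le_iff]
        have h4 := Real.sqrt_nonneg (catProb β x k * catProb β₀ x k)
        have h5 := Real.sqrt_nonneg δ
        have h6 : 0 ≤ catProb β x k * catProb β₀ x k := by positivity
        refine ⟨by positivity, ?_⟩
        nlinarith [Real.sq_sqrt h6, Real.sq_sqrt hδ, mul_nonneg h4 h5]
      rw [h1]
      linarith [sqrt_mul_le_of_le_one hp (catProb_le_one β x k) hp0.le (catProb_le_one β₀ x k)]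
    refine (Finset.sum_le_sum fun k _ => hk k).trans (le_of_eq ?_)
    rw [Finset.sum_add_distrib, Finset.sum_sub_distrib, ← Finset.sum_div, ← Finset.sum_div,
      Finset.sum_add_distrib, sum_catProb, sum_catProb]
    simp only [Finset.sum_const, Finset.card_univ, Fintype.card_fin, nsmul_eq_mul]
    push_cast
    ring
  refine (lintegral_mono hpt).trans ?_
  -- Ensures that the pointwise bound is nonnegative, so that its lower integral is the Bochner
  -- integral.
  have hsum : ∀ x, ∑ k, |catProb β x k - catProb β₀ x k| ^ 2 ≤ 2 := by
    intro x
    have : ∀ k, |catProb β x k - catProb β₀ x k| ^ 2 ≤ catProb β x k + catProb β₀ x k := fun k => by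
      have hp := catProb_nonneg β x k
      have hp0 := catProb_nonneg β₀ x k
      rw [sq_abs]
      nlinarith [catProb_le_one β x k, catProb_le_one β₀ x k, mul_nonneg hp hp0]
    refine (Finset.sum_le_sum fun k _ => this k).trans (le_of_eq ?_)
    rw [Finset.sum_add_distrib, sum_catProb, sum_catProb]
    norm_num
  rw [← ofReal_integral_eq_lintegral_ofReal]
  · refine ENNReal.ofReal_le_ofReal ?_
    rw [integral_sub (integrable_const _) ((integrable_finsetSum _ fun k _ => hint k).div_const _),
      integral_div, integral_finsetSum _ fun k _ => hint k, ← catDist_sq]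
    simp only [integral_const, probReal_univ, smul_eq_mul, one_mul]
    have := Real.add_one_le_exp (-(catDist G β β₀ ^ 2 / 8) + (q + 1) * √δ)
    linarith
  · exact (integrable_const _).sub ((integrable_finsetSum _ fun k _ => hint k).div_const _)
  · refine ae_of_all _ fun x => ?_
    have := hsum x
    have h2 := Real.sqrt_nonneg δ
    simp only [Pi.zero_apply]
    have : 0 ≤ ((q : ℝ) + 1) * √δ := by positivity
    linarith

end Observation

/-! ### Integrals with respect to the prior -/

section Prior

variable {q : ℕ} {ρ : Measure ℕ} {τ : (J : ℕ) → Measure (Fin q → Fin J → ℝ)}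

lemma measurable_of_sigma {X : Type*} [MeasurableSpace X] {f : Param q → X}
    (hf : ∀ J, Measurable fun Θ => f ⟨J, Θ⟩) : Measurable f := fun _ hs =>
  MeasurableSpace.measurableSet_iInf.2 fun J => hf J hs

/-- The parameters of dimension `J` in `F`. -/
def dimSlice {q : ℕ} (J : ℕ) (F : Set (Param q)) : Set (Fin q → Fin J → ℝ) := {Θ | ⟨J, Θ⟩ ∈ F}

lemma measurable_sigmaMk (J : ℕ) :
    Measurable (Sigma.mk (β := fun J => Fin q → Fin J → ℝ) J) := fun _ hs =>
  MeasurableSpace.measurableSet_iInf.1 hs J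

lemma lintegral_prior {f : Param q → ℝ≥0∞} (hf : Measurable f) :
    ∫⁻ p, f p ∂(prior ρ τ) = ∑' J, ρ {J} * ∫⁻ Θ, f ⟨J, Θ⟩ ∂(τ J) := by
  rw [prior, lintegral_sum_measure]
  refine tsum_congr fun J => ?_
  rw [lintegral_smul_measure, lintegral_map hf (measurable_sigmaMk J), smul_eq_mul]

instance [IsProbabilityMeasure ρ] [∀ J, IsProbabilityMeasure (τ J)] :
    IsProbabilityMeasure (prior ρ τ) := by
  constructor
  rw [← lintegral_one, lintegral_prior measurable_const]
  simp only [lintegral_one, measure_univ, mul_one]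
  have := lintegral_countable' (μ := ρ) (fun _ => 1)
  simpa using this.symm

end Prior

/-! ### Non-asymptotic bounds -/

section Bounds

variable {q n : ℕ} {G : Measure Curve} [IsProbabilityMeasure G] {β₀ : Fin q → ℝ → ℝ}
  {B₀ : Fin q → ℝ} {ψ : (J : ℕ) → Fin J → ℝ → ℝ} {C K₀ : ℝ}
  {ρ : Measure ℕ} [IsProbabilityMeasure ρ] {τ : (J : ℕ) → Measure (Fin q → Fin J → ℝ)}
  [∀ J, IsProbabilityMeasure (τ J)]

/-- The likelihood ratio of the sample. -/
noncomputable def sampleRatio (ψ : (J : ℕ) → Fin J → ℝ → ℝ) (β₀ : Fin q → ℝ → ℝ)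
    (D : Fin n → Curve × Fin (q + 1)) (p : Param q) : ℝ≥0∞ :=
  ∏ i, ratio (coefFun ψ p) β₀ (D i)

lemma likelihood_eq (D : Fin n → Curve × Fin (q + 1)) (p : Param q) :
    likelihood ψ D p =
      (∏ i, ENNReal.ofReal (catProb β₀ (D i).1 (D i).2)) * sampleRatio ψ β₀ D p := by
  rw [likelihood, sampleRatio, ← Finset.prod_mul_distrib]
  refine Finset.prod_congr rfl fun i _ => ?_
  rw [ratio, ← ENNReal.ofReal_mul (catProb_nonneg _ _ _),
    mul_div_cancel₀ _ (catProb_pos β₀ _ _).ne']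

lemma ratio_ne_zero (β : Fin q → ℝ → ℝ) (z : Curve × Fin (q + 1)) : ratio β β₀ z ≠ 0 := by
  rw [ratio, ne_eq, ENNReal.ofReal_eq_zero, not_le]
  exact div_pos (catProb_pos _ _ _) (catProb_pos _ _ _)

lemma ratio_ne_top (β : Fin q → ℝ → ℝ) (z : Curve × Fin (q + 1)) : ratio β β₀ z ≠ ∞ :=
  ENNReal.ofReal_ne_top

lemma StableBasis.measurable_uncurry_ratio (h : StableBasis ψ C K₀)
    (h₀ : ∀ l, BddCoef (β₀ l) (B₀ l)) (J : ℕ) :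
    Measurable (Function.uncurry fun (Θ : Fin q → Fin J → ℝ) (z : Curve × Fin (q + 1)) =>
      ratio (coefFun ψ ⟨J, Θ⟩) β₀ z) :=
  ((h.measurable_catProb_series J).div ((measurable_catProb h₀).comp measurable_snd)).ennreal_ofReal

lemma StableBasis.bddCoef_coefFun (h : StableBasis ψ C K₀) (p : Param q) (l : Fin q) :
    BddCoef (coefFun ψ p l) (C * (p.1 : ℝ) ^ K₀ * Real.sqrt (∑ j, p.2 l j ^ 2)) :=
  h.bddCoef_series (p.2 l)

lemma StableBasis.measurable_sampleRatio (h : StableBasis ψ C K₀)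
    (h₀ : ∀ l, BddCoef (β₀ l) (B₀ l)) (D : Fin n → Curve × Fin (q + 1)) :
    Measurable (sampleRatio ψ β₀ D) :=
  measurable_of_sigma fun J => Finset.measurable_fun_prod _ fun i _ =>
    (h.measurable_uncurry_ratio h₀ J).of_uncurry_right (y := D i)

/-- A lower bound for the integrated likelihood ratio. -/
lemma StableBasis.measure_evidence_le
    (h : StableBasis ψ C K₀) (h₀ : ∀ l, BddCoef (β₀ l) (B₀ l))
    {J : ℕ} {U : Set (Fin q → Fin J → ℝ)} (hU : MeasurableSet U) {c d t a : ℝ} (hc : 0 < c)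
    (hcU : ∀ Θ ∈ U, ∀ᵐ x ∂G, ∀ k, c ≤ catProb (coefFun ψ ⟨J, Θ⟩) x k)
    (hdU : ∀ Θ ∈ U, ∀ᵐ x ∂G, ∀ k, |catProb (coefFun ψ ⟨J, Θ⟩) x k - catProb β₀ x k| ≤ d)
    (ha : Real.exp (-a) ≤ ρ.real {J} * (τ J).real U * Real.exp (-t)) :
    (Measure.pi fun _ : Fin n => obsLaw G β₀)
      {D | ∫⁻ p, sampleRatio ψ β₀ D p ∂(prior ρ τ) < ENNReal.ofReal (Real.exp (-a))} ≤
      ENNReal.ofReal (Real.exp (n * ((q + 1) * d ^ 2 / c) - t)) := by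
  have := isProbabilityMeasure_obsLaw (G := G) h₀
  have hκ : ENNReal.ofReal (Real.exp t) ≠ 0 := by simp [Real.exp_pos]
  have key := measure_evidence_lt_le (n := n) (P := obsLaw G β₀) (ν := (τ J).restrict U)
    (h.measurable_uncurry_ratio h₀ J) (fun _ _ => ratio_ne_zero _ _) (fun _ _ => ratio_ne_top _ _)
    (A := ENNReal.ofReal (Real.exp ((q + 1) * d ^ 2 / c)))
    ((ae_restrict_iff' hU).2 (ae_of_all _ fun Θ hΘ => lintegral_inv_ratio_le
      (h.bddCoef_coefFun ⟨J, Θ⟩) h₀ hc (hcU Θ hΘ) (hdU Θ hΘ))) hκ ENNReal.ofReal_ne_top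
  refine (measure_mono ?_).trans (key.trans (le_of_eq ?_))
  · intro D hD
    simp only [Set.mem_ofPred_eq] at hD ⊢
    rw [lintegral_prior (h.measurable_sampleRatio h₀ D)] at hD
    by_contra! hle
    refine absurd hD (not_lt.2 ?_)
    refine le_trans ?_ (ENNReal.le_tsum J)
    have h1 : ENNReal.ofReal (Real.exp (-a)) ≤
        ρ {J} * ((ENNReal.ofReal (Real.exp t))⁻¹ * (τ J) U) := by
      rw [← ENNReal.ofReal_inv_of_pos (Real.exp_pos _), ← Real.exp_neg,
        ← ofReal_measureReal (μ := ρ), ← ofReal_measureReal (μ := τ J),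
        ← ENNReal.ofReal_mul (Real.exp_nonneg _), ← ENNReal.ofReal_mul measureReal_nonneg]
      refine ENNReal.ofReal_le_ofReal (ha.trans (le_of_eq ?_))
      ring
    rw [Measure.restrict_apply_univ] at hle
    refine h1.trans ?_
    gcongr
    exact hle.trans (lintegral_mono' Measure.restrict_le_self le_rfl)
  · rw [← ENNReal.ofReal_pow (Real.exp_nonneg _), ← ENNReal.ofReal_div_of_pos (Real.exp_pos _),
      ← Real.exp_nat_mul, ← Real.exp_sub]

/-- The sieve of parameters with dimension at most `Jb` and coefficients in `[-M, M]`. -/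
def sieve (q Jb : ℕ) (M : ℝ) : Set (Param q) := {p | p.1 ≤ Jb ∧ ∀ l j, |p.2 l j| ≤ M}

lemma measurableSet_sieve (q Jb : ℕ) (M : ℝ) : MeasurableSet (sieve q Jb M) := by
  refine MeasurableSpace.measurableSet_iInf.2 fun J => ?_
  change MeasurableSet {Θ : Fin q → Fin J → ℝ | J ≤ Jb ∧ ∀ l j, |Θ l j| ≤ M}
  rw [Set.ofPred_and, Set.ofPred_forall]
  refine MeasurableSet.inter (MeasurableSet.const _) (MeasurableSet.iInter fun l => ?_)
  rw [Set.ofPred_forall]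
  exact MeasurableSet.iInter fun j => measurableSet_le (by fun_prop) measurable_const

/-- Each likelihood ratio has mean one under the truth, so the integral over `F` has mean equal to
the prior mass of `F`; then Markov. -/
lemma StableBasis.measure_sieve_compl_le (h : StableBasis ψ C K₀)
    (h₀ : ∀ l, BddCoef (β₀ l) (B₀ l)) {F : Set (Param q)} (hF : MeasurableSet F) {x c : ℝ}
    (hx : (prior ρ τ).real F ≤ x) :
    (Measure.pi fun _ : Fin n => obsLaw G β₀)
      {D | ENNReal.ofReal (Real.exp (-c)) ≤ ∫⁻ p in F, sampleRatio ψ β₀ D p ∂(prior ρ τ)} ≤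
      ENNReal.ofReal (x * Real.exp c) := by
  have := isProbabilityMeasure_obsLaw (G := G) h₀
  have hFJ : ∀ J, MeasurableSet (dimSlice J F) := fun J => measurable_sigmaMk J hF
  have hset : ∀ f : Param q → ℝ≥0∞, Measurable f → ∫⁻ p in F, f p ∂(prior ρ τ) =
      ∑' J, ∫⁻ Θ, f ⟨J, Θ⟩ ∂(ρ {J} • (τ J).restrict (dimSlice J F)) := by
    intro f hf
    rw [← lintegral_indicator hF, lintegral_prior (hf.indicator hF)]
    refine tsum_congr fun J => ?_
    rw [lintegral_smul_measure, ← lintegral_indicator (hFJ J), smul_eq_mul]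
    rfl
  have hfin : ∀ J, IsFiniteMeasure (ρ {J} • (τ J).restrict (dimSlice J F)) := fun J =>
    ⟨by
      rw [Measure.smul_apply, smul_eq_mul]
      exact ENNReal.mul_lt_top (measure_lt_top _ _) (measure_lt_top _ _)⟩
  have key := measure_le_tsum_lintegral_le (n := n) (P := obsLaw G β₀)
    (ν := fun J => ρ {J} • (τ J).restrict (dimSlice J F))
    (fun J => h.measurable_uncurry_ratio h₀ J)
    (fun J Θ => (lintegral_ratio (h.bddCoef_coefFun ⟨J, Θ⟩) h₀).le)
    (κ := ENNReal.ofReal (Real.exp (-c))) (by simp [Real.exp_pos]) ENNReal.ofReal_ne_top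
  have h1 : ∑' J, (ρ {J} • (τ J).restrict (dimSlice J F)) Set.univ = prior ρ τ F := by
    have := hset (fun _ => 1) measurable_const
    simp only [lintegral_one, Measure.restrict_apply_univ] at this
    exact this.symm
  rw [h1] at key
  refine (measure_mono ?_).trans (key.trans ?_)
  · intro D hD
    simp only [Set.mem_ofPred_eq] at hD ⊢
    rw [hset _ (h.measurable_sampleRatio h₀ D)] at hD
    exact hD
  · rw [← ofReal_measureReal (μ := prior ρ τ), ← ENNReal.ofReal_div_of_pos (Real.exp_pos _)]
    refine ENNReal.ofReal_le_ofReal ?_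
    rw [Real.exp_neg, div_inv_eq_mul]
    gcongr

/-- The Euclidean norm is at most `√J m`, bounded crudely by `J m`: polynomial factors in the mesh
enter the entropy only through a logarithm. -/
lemma StableBasis.abs_series_sub_le (h : StableBasis ψ C K₀) {J : ℕ} {θ θ' : Fin J → ℝ} {m : ℝ}
    (hm : 0 ≤ m) (hθ : ∀ j, |θ j - θ' j| ≤ m) {t : ℝ} (ht : t ∈ Set.Icc (0 : ℝ) 1) :
    |series ψ θ t - series ψ θ' t| ≤ C * (J : ℝ) ^ K₀ * (J * m) := by
  refine (h.stable J θ θ' t ht).trans ?_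
  have hC := h.pos
  gcongr
  rw [Real.sqrt_le_iff]
  refine ⟨by positivity, ?_⟩
  calc ∑ j, (θ j - θ' j) ^ 2 ≤ ∑ _j : Fin J, m ^ 2 := Finset.sum_le_sum fun j _ =>
        sq_le_sq.2 ((hθ j).trans (le_abs_self m))
    _ = J * m ^ 2 := by simp
    _ ≤ (J * m) ^ 2 := by
        rcases Nat.eq_zero_or_pos J with h0 | h0
        · simp [h0]
        · have : (1 : ℝ) ≤ J := by exact_mod_cast h0
          nlinarith [sq_nonneg m, mul_nonneg (sub_nonneg.2 this) (sq_nonneg m)]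

lemma floor_cell {M m u : ℝ} {N : ℕ} (hm : 0 < m) (hN : 2 * M / m < N)
    (hu : |u| ≤ M) : ⌊(u + M) / m⌋₊ < N := by
  have h := abs_le.1 hu
  rw [Nat.floor_lt (div_nonneg (by linarith) hm.le)]
  refine lt_of_le_of_lt ?_ hN
  gcongr
  linarith

lemma abs_sub_le_of_floor_eq {M m u v : ℝ} (hm : 0 < m) (hu : |u| ≤ M) (hv : |v| ≤ M)
    (h : ⌊(u + M) / m⌋₊ = ⌊(v + M) / m⌋₊) : |u - v| ≤ m := by
  have hu' := abs_le.1 hu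
  have hv' := abs_le.1 hv
  have h1 := Nat.floor_le (div_nonneg (by linarith : 0 ≤ u + M) hm.le)
  have h2 := Nat.floor_le (div_nonneg (by linarith : 0 ≤ v + M) hm.le)
  have h3 := Nat.lt_floor_add_one ((u + M) / m)
  have h4 := Nat.lt_floor_add_one ((v + M) / m)
  rw [h] at h1 h3
  rw [le_div_iff₀ hm] at h1 h2
  rw [div_lt_iff₀ hm] at h3 h4
  rw [abs_le]
  constructor <;> nlinarith

lemma ae_norm_le_sample {R : ℝ} (h₀ : ∀ l, BddCoef (β₀ l) (B₀ l)) (hR : ∀ᵐ x ∂G, ‖x‖ ≤ R) :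
    ∀ᵐ D ∂(Measure.pi fun _ : Fin n => obsLaw G β₀), ∀ i, ‖(D i).1‖ ≤ R := by
  have := isProbabilityMeasure_obsLaw (G := G) h₀
  have h1 : ∀ᵐ z ∂(obsLaw G β₀), ‖z.1‖ ≤ R :=
    (withDensity_absolutelyContinuous _ _).ae_le
      (Measure.quasiMeasurePreserving_fst.ae hR)
  exact eventually_all.2 fun i =>
    (Measure.quasiMeasurePreserving_eval (fun _ : Fin n => obsLaw G β₀) i).ae h1

/-- The probability that some parameter of the sieve that is far from the truth has a large
likelihood ratio. -/
lemma StableBasis.measure_sieve_le (h : StableBasis ψ C K₀) (h₀ : ∀ l, BddCoef (β₀ l) (B₀ l))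
    {R : ℝ} (hR : ∀ᵐ x ∂G, ‖x‖ ≤ R) {Jb N : ℕ} {M m δ η b : ℝ} (hm : 0 < m)
    (hN : 2 * M / m < N) (hN1 : 1 ≤ N) (hδ : 0 ≤ δ) (hη : 0 ≤ η)
    (hcell : ∀ J ≤ Jb, 2 * (q + 1) * R * (C * (J : ℝ) ^ K₀ * (J * m)) ≤ δ) :
    (Measure.pi fun _ : Fin n => obsLaw G β₀)
      {D | ∃ p ∈ sieve q Jb M, η ≤ catDist G (coefFun ψ p) β₀ ∧
        ENNReal.ofReal (Real.exp (-b)) < sampleRatio ψ β₀ D p} ≤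
      ENNReal.ofReal ((Jb + 1) * (N : ℝ) ^ (q * Jb) *
        Real.exp (b / 2 + n * (-(η ^ 2 / 8) + (q + 1) * √δ))) := by
  have := isProbabilityMeasure_obsLaw (G := G) h₀
  set Pn := Measure.pi fun _ : Fin n => obsLaw G β₀
  set y : ℝ := Real.exp (b / 2 + n * (-(η ^ 2 / 8) + (q + 1) * √δ)) with hy
  let S : (J : ℕ) → (Fin q → Fin J → Fin N) → Set (Fin q → Fin J → ℝ) := fun J c =>
    {Θ | (∀ l j, |Θ l j| ≤ M) ∧ η ≤ catDist G (coefFun ψ ⟨J, Θ⟩) β₀ ∧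
      ∀ l j, ⌊(Θ l j + M) / m⌋₊ = c l j}
  let E : (J : ℕ) → (Fin q → Fin J → Fin N) → Set (Fin n → Curve × Fin (q + 1)) := fun J c =>
    {D | ∃ Θ ∈ S J c, ENNReal.ofReal (Real.exp (-b)) < sampleRatio ψ β₀ D ⟨J, Θ⟩}
  have hE : ∀ J ≤ Jb, ∀ c, Pn (E J c) ≤ ENNReal.ofReal y := by
    intro J hJ c
    -- The bracket is centred at a member of the cell that is itself at distance at least `η`, so no
    -- distance is lost. Choosing cells by membership also avoids measurability of the events `E J
    -- c`: only outer measure is used.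
    rcases (S J c).eq_empty_or_nonempty with hS | ⟨Θ₁, h1M, h1d, h1c⟩
    · simp [E, hS]
    set w : Curve × Fin (q + 1) → ℝ≥0∞ := fun z =>
      ENNReal.ofReal √((catProb (coefFun ψ ⟨J, Θ₁⟩) z.1 z.2 + δ) / catProb β₀ z.1 z.2) with hw
    have hwm : Measurable w :=
      (((measurable_catProb (h.bddCoef_coefFun ⟨J, Θ₁⟩)).add_const δ).div
        (measurable_catProb h₀)).sqrt.ennreal_ofReal
    -- `w` is the square root of a bracketing ratio, so the threshold `exp(-b)` for ratios becomes
    -- `exp(-b/2)`.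
    have key := measure_le_prod_le (n := n) (P := obsLaw G β₀) hwm
      (κ := ENNReal.ofReal (Real.exp (-b / 2))) (by simp [Real.exp_pos]) ENNReal.ofReal_ne_top
      (lintegral_sqrt_bracket_le (h.bddCoef_coefFun ⟨J, Θ₁⟩) h₀ hδ)
    refine (measure_mono_ae ?_).trans (key.trans ?_)
    · filter_upwards [ae_norm_le_sample (n := n) h₀ hR] with D hD
      rintro ⟨Θ, ⟨hM, -, hc⟩, hlt⟩
      change ENNReal.ofReal (Real.exp (-b / 2)) ≤ ∏ i, w (D i)
      have hclose : ∀ i, catProb (coefFun ψ ⟨J, Θ⟩) (D i).1 (D i).2 ≤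
          catProb (coefFun ψ ⟨J, Θ₁⟩) (D i).1 (D i).2 + δ := by
        intro i
        have hC := h.pos
        have h2 := abs_catProb_sub_le (d := C * (J : ℝ) ^ K₀ * (J * m)) (by positivity)
          (h.bddCoef_coefFun ⟨J, Θ⟩)
          (h.bddCoef_coefFun ⟨J, Θ₁⟩) (fun l t ht => h.abs_series_sub_le hm.le
            (fun j => abs_sub_le_of_floor_eq hm (hM l j) (h1M l j)
              ((hc l j).trans (h1c l j).symm)) ht) (hD i) (D i).2
        linarith [(abs_le.1 h2).2, hcell J hJ]
      have hsq : ∀ i, ratio (coefFun ψ ⟨J, Θ⟩) β₀ (D i) ≤ w (D i) ^ 2 := by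
        intro i
        rw [hw, ← ENNReal.ofReal_pow (Real.sqrt_nonneg _), Real.sq_sqrt (div_nonneg
          (add_nonneg (catProb_nonneg _ _ _) hδ) (catProb_nonneg _ _ _)), ratio]
        refine ENNReal.ofReal_le_ofReal ?_
        exact div_le_div_of_nonneg_right (hclose i) (catProb_nonneg _ _ _)
      have h3 : sampleRatio ψ β₀ D ⟨J, Θ⟩ ≤ (∏ i, w (D i)) ^ 2 := by
        rw [← Finset.prod_pow]
        exact Finset.prod_le_prod' fun i _ => hsq i
      have h4 : ENNReal.ofReal (Real.exp (-b / 2)) ^ 2 ≤ (∏ i, w (D i)) ^ 2 := by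
        rw [← ENNReal.ofReal_pow (Real.exp_nonneg _), ← Real.exp_nat_mul]
        refine le_trans (le_of_eq ?_) (hlt.le.trans h3)
        congr 2
        push_cast
        ring
      exact (ENNReal.pow_le_pow_left_iff two_ne_zero).1 h4
    · rw [← ENNReal.ofReal_pow (Real.exp_nonneg _), ← ENNReal.ofReal_div_of_pos (Real.exp_pos _),
        ← Real.exp_nat_mul, ← Real.exp_sub]
      refine ENNReal.ofReal_le_ofReal (Real.exp_le_exp.2 ?_)
      have h5 : η ^ 2 ≤ catDist G (coefFun ψ ⟨J, Θ₁⟩) β₀ ^ 2 := by gcongr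
      have h6 : (n : ℝ) * (-(catDist G (coefFun ψ ⟨J, Θ₁⟩) β₀ ^ 2 / 8) + (q + 1) * √δ) ≤
          n * (-(η ^ 2 / 8) + (q + 1) * √δ) := by gcongr
      linarith
  have hcov : {D | ∃ p ∈ sieve q Jb M, η ≤ catDist G (coefFun ψ p) β₀ ∧
      ENNReal.ofReal (Real.exp (-b)) < sampleRatio ψ β₀ D p} ⊆
      ⋃ J ∈ Finset.range (Jb + 1), ⋃ c, E J c := by
    rintro D ⟨⟨J, Θ⟩, ⟨hJ, hM⟩, hd, hlt⟩
    refine Set.mem_biUnion (Finset.mem_coe.2 (Finset.mem_range.2 (Nat.lt_succ_of_le hJ))) ?_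
    refine Set.mem_iUnion.2 ⟨fun l j => ⟨⌊(Θ l j + M) / m⌋₊, floor_cell hm hN (hM l j)⟩, ?_⟩
    exact ⟨Θ, ⟨hM, hd, fun l j => rfl⟩, hlt⟩
  have hJb : ∀ J ∈ Finset.range (Jb + 1), Pn (⋃ c, E J c) ≤
      (N : ℝ≥0∞) ^ (q * Jb) * ENNReal.ofReal y := by
    intro J hJ
    have hJ' : J ≤ Jb := Nat.lt_succ_iff.1 (Finset.mem_range.1 hJ)
    calc Pn (⋃ c, E J c) ≤ ∑ c, Pn (E J c) := measure_iUnion_fintype_le _ _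
      _ ≤ ∑ _c : Fin q → Fin J → Fin N, ENNReal.ofReal y := Finset.sum_le_sum fun c _ => hE J hJ' c
      _ = (N : ℝ≥0∞) ^ (q * J) * ENNReal.ofReal y := by
          simp [pow_mul, mul_comm q J]
      _ ≤ _ := by
          gcongr
          exact_mod_cast hN1
  refine (measure_mono hcov).trans ((measure_biUnion_finset_le _ _).trans
    ((Finset.sum_le_sum hJb).trans (le_of_eq ?_)))
  rw [Finset.sum_const, Finset.card_range, nsmul_eq_mul, ENNReal.ofReal_mul (by positivity),
    ENNReal.ofReal_mul (by positivity), ENNReal.ofReal_pow (by positivity), ENNReal.ofReal_natCast,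
    ENNReal.ofReal_add (by positivity) zero_le_one, ENNReal.ofReal_natCast, ENNReal.ofReal_one]
  push_cast
  ring

/-- A bound for the posterior on the event where the evidence is not too small and the likelihood
ratios far from the truth are small. -/
lemma StableBasis.posteriorProb_le (h : StableBasis ψ C K₀) (h₀ : ∀ l, BddCoef (β₀ l) (B₀ l))
    {D : Fin n → Curve × Fin (q + 1)} {F B : Set (Param q)} {a b c : ℝ}
    (h1 : ENNReal.ofReal (Real.exp (-a)) ≤ ∫⁻ p, sampleRatio ψ β₀ D p ∂(prior ρ τ))
    (h2 : ∀ p ∈ F, p ∈ B → sampleRatio ψ β₀ D p ≤ ENNReal.ofReal (Real.exp (-b)))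
    (h3 : ∫⁻ p in Fᶜ, sampleRatio ψ β₀ D p ∂(prior ρ τ) ≤ ENNReal.ofReal (Real.exp (-c))) :
    posteriorProb (prior ρ τ) ψ D B ≤ ENNReal.ofReal (Real.exp (a - b) + Real.exp (a - c)) := by
  have hm := h.measurable_sampleRatio h₀ D
  -- The true likelihood does not depend on the parameter and is positive and finite, so it cancels
  -- in Bayes's formula.
  set L₀ := ∏ i, ENNReal.ofReal (catProb β₀ (D i).1 (D i).2) with hL₀
  have hL0 : L₀ ≠ 0 := Finset.prod_ne_zero_iff.2 fun i _ => by
    simpa using catProb_pos β₀ (D i).1 (D i).2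
  have hL1 : L₀ ≠ ∞ := ENNReal.prod_ne_top fun i _ => ENNReal.ofReal_ne_top
  rw [posteriorProb]
  simp only [likelihood_eq (β₀ := β₀), ← hL₀]
  rw [lintegral_const_mul _ hm, lintegral_const_mul _ hm, ENNReal.mul_div_mul_left _ _ hL0 hL1]
  have h4 : ∫⁻ p in B, sampleRatio ψ β₀ D p ∂(prior ρ τ) ≤
      ENNReal.ofReal (Real.exp (-b)) + ENNReal.ofReal (Real.exp (-c)) := by
    calc _ ≤ ∫⁻ p in (B ∩ F) ∪ Fᶜ, sampleRatio ψ β₀ D p ∂(prior ρ τ) := by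
          refine lintegral_mono_set fun p hp => ?_
          by_cases hpF : p ∈ F
          · exact Or.inl ⟨hp, hpF⟩
          · exact Or.inr hpF
      _ ≤ _ := lintegral_union_le _ _ _
      _ ≤ _ := by
          gcongr
          calc _ ≤ ∫⁻ _ in B ∩ F, ENNReal.ofReal (Real.exp (-b)) ∂(prior ρ τ) :=
                setLIntegral_mono measurable_const fun p hp => h2 p hp.2 hp.1
            _ ≤ ENNReal.ofReal (Real.exp (-b)) * 1 := by
                rw [setLIntegral_const]
                gcongr
                exact prob_le_one
            _ = _ := mul_one _
  calc _ ≤ (ENNReal.ofReal (Real.exp (-b)) + ENNReal.ofReal (Real.exp (-c))) /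
        ENNReal.ofReal (Real.exp (-a)) := by gcongr
    _ = _ := by
      rw [← ENNReal.ofReal_add (Real.exp_nonneg _) (Real.exp_nonneg _),
        ← ENNReal.ofReal_div_of_pos (Real.exp_pos _), add_div, ← Real.exp_sub, ← Real.exp_sub]
      ring_nf

end Bounds

/-! ### The optimal dimension and the rate -/

/-- The optimal dimension `(n / log n)^{1/(2α+1)}`. -/
noncomputable def optDim (α : ℝ) (n : ℕ) : ℝ := ((n : ℝ) / Real.log n) ^ (1 / (2 * α + 1))

lemma eventually_one_le_log : ∀ᶠ n : ℕ in atTop, 1 ≤ Real.log n :=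
  (Real.tendsto_log_atTop.comp tendsto_natCast_atTop_atTop).eventually_ge_atTop 1

/-- Eventually `log n ≤ √n`, so `n / log n ≥ √n`. It makes the logarithm of the optimal dimension
comparable with `log n`. -/
lemma eventually_rpow_le_optDim {α : ℝ} (hα : 0 < α) :
    ∀ᶠ n : ℕ in atTop, (n : ℝ) ^ (1 / (2 * (2 * α + 1))) ≤ optDim α n := by
  have h1 : ∀ᶠ n : ℕ in atTop, ‖Real.log n‖ ≤ 1 * ‖(n : ℝ) ^ (1 / 2 : ℝ)‖ :=
    tendsto_natCast_atTop_atTop.eventually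
      ((isLittleO_log_rpow_atTop (by norm_num : (0 : ℝ) < 1 / 2)).bound one_pos)
  filter_upwards [h1, eventually_one_le_log, eventually_gt_atTop 0] with n hn hl hn0
  have hn0' : (0 : ℝ) < n := Nat.cast_pos.2 hn0
  rw [one_mul, Real.norm_of_nonneg (by linarith), Real.norm_of_nonneg (by positivity)] at hn
  have h2 : (n : ℝ) ^ (1 / 2 : ℝ) ≤ n / Real.log n := by
    rw [le_div_iff₀ (by linarith)]
    calc (n : ℝ) ^ (1 / 2 : ℝ) * Real.log n ≤ (n : ℝ) ^ (1 / 2 : ℝ) * (n : ℝ) ^ (1 / 2 : ℝ) := by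
          gcongr
      _ = n := by rw [← Real.rpow_add hn0']; norm_num
  calc (n : ℝ) ^ (1 / (2 * (2 * α + 1))) = ((n : ℝ) ^ (1 / 2 : ℝ)) ^ (1 / (2 * α + 1)) := by
        rw [← Real.rpow_mul hn0'.le]
        congr 1
        field_simp
    _ ≤ _ := Real.rpow_le_rpow (by positivity) h2 (by positivity)

lemma tendsto_optDim {α : ℝ} (hα : 0 < α) : Tendsto (optDim α) atTop atTop :=
  tendsto_atTop_mono' _ (eventually_rpow_le_optDim hα)
    ((tendsto_rpow_atTop (by positivity)).comp tendsto_natCast_atTop_atTop)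

lemma eventually_mul_log_le_log_optDim {α : ℝ} (hα : 0 < α) :
    ∀ᶠ n : ℕ in atTop, 1 / (2 * (2 * α + 1)) * Real.log n ≤ Real.log (optDim α n) := by
  filter_upwards [eventually_rpow_le_optDim hα, eventually_gt_atTop 0] with n hn hn0
  have hn0' : (0 : ℝ) < n := Nat.cast_pos.2 hn0
  rw [← Real.log_rpow hn0']
  exact Real.log_le_log (by positivity) hn

lemma eventually_optDim_le {α : ℝ} (hα : 0 < α) : ∀ᶠ n : ℕ in atTop, optDim α n ≤ n := by
  filter_upwards [eventually_one_le_log, eventually_gt_atTop 0] with n hl hn0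
  have hn0' : (1 : ℝ) ≤ n := Nat.one_le_cast.2 hn0
  have hpos : 0 < Real.log n := by linarith
  calc optDim α n ≤ (n : ℝ) ^ (1 / (2 * α + 1)) := by
        refine Real.rpow_le_rpow (by positivity) (div_le_self (by positivity) hl) (by positivity)
    _ ≤ (n : ℝ) ^ (1 : ℝ) := by
        refine Real.rpow_le_rpow_of_exponent_le hn0' ?_
        rw [div_le_one (by positivity)]
        linarith
    _ = n := Real.rpow_one _

/-- The balance that defines the optimal dimension: `n` times squared bias equals dimension times
`log n`. -/
lemma eventually_mul_optDim_rpow {α : ℝ} (hα : 0 < α) :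
    ∀ᶠ n : ℕ in atTop, n * optDim α n ^ (-(2 * α)) = optDim α n * Real.log n := by
  filter_upwards [eventually_one_le_log, eventually_gt_atTop 0,
    (tendsto_optDim hα).eventually_gt_atTop 0] with n hl hn0 hy
  have hn0' : (0 : ℝ) < n := Nat.cast_pos.2 hn0
  have hpos : 0 < Real.log n := by linarith
  have h1 : optDim α n ^ (2 * α + 1) = n / Real.log n := by
    rw [optDim, ← Real.rpow_mul (by positivity), one_div, inv_mul_cancel₀ (by positivity),
      Real.rpow_one]
  have h2 : (n : ℝ) = optDim α n ^ (2 * α + 1) * Real.log n := by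
    rw [h1]
    field_simp
  calc n * optDim α n ^ (-(2 * α))
      = optDim α n ^ (2 * α + 1) * optDim α n ^ (-(2 * α)) * Real.log n := by
        nth_rewrite 1 [h2]
        ring
    _ = _ := by
        have h3 : 2 * α + 1 + -(2 * α) = 1 := by ring
        rw [← Real.rpow_add hy, h3, Real.rpow_one]

lemma eventually_mul_rate_sq {α : ℝ} (hα : 0 < α) (t : ℝ) :
    ∀ᶠ n : ℕ in atTop, n * ((n : ℝ) ^ (-α / (2 * α + 1)) *
        Real.log n ^ (α / (2 * α + 1) + (1 - t) / 2)) ^ 2 =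
      optDim α n * Real.log n * Real.log n ^ (1 - t) := by
  filter_upwards [eventually_one_le_log, eventually_gt_atTop 0,
    eventually_mul_optDim_rpow hα] with n hl hn0 hy
  have hn0' : (0 : ℝ) < n := Nat.cast_pos.2 hn0
  have hpos : 0 < Real.log n := by linarith
  rw [← hy, mul_assoc, optDim, ← Real.rpow_mul (by positivity), Real.div_rpow hn0'.le hpos.le,
    mul_pow, ← Real.rpow_natCast, ← Real.rpow_natCast, ← Real.rpow_mul hn0'.le,
    ← Real.rpow_mul hpos.le]
  have h3 : ∀ x b c : ℝ, x / Real.log n ^ b * Real.log n ^ c = x * Real.log n ^ (c - b) := by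
    intro x b c
    rw [Real.rpow_sub hpos]
    ring
  rw [h3]
  congr 3
  · push_cast
    field_simp
  · push_cast
    field_simp
    ring

/-! ### Prior mass outside the sieve -/

section Sieve

variable {q : ℕ} {ρ : Measure ℕ} [IsProbabilityMeasure ρ]
  {τ : (J : ℕ) → Measure (Fin q → Fin J → ℝ)} [∀ J, IsProbabilityMeasure (τ J)]

/-- Dimensions up to `Jb` contribute through large coefficients, weighted by `ρ` of total mass one;
larger dimensions contribute their whole prior weight. -/
lemma prior_sieve_compl_le (Jb : ℕ) (M : ℝ) {x : ℝ} (hx : 0 ≤ x)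
    (hτ : ∀ J ≤ Jb, (τ J).real {Θ | ∃ l j, M < |Θ l j|} ≤ x) {f : ℕ → ℝ} (hf : ∀ J, 0 ≤ f J)
    (hfs : Summable f) (hρ : ∀ J, Jb < J → ρ.real {J} ≤ f J) :
    (prior ρ τ).real (sieve q Jb M)ᶜ ≤ x + ∑' J, f J := by
  have hm := (measurableSet_sieve q Jb M).compl
  have h1 : prior ρ τ (sieve q Jb M)ᶜ ≤ ENNReal.ofReal (x + ∑' J, f J) := by
    rw [← lintegral_indicator_one hm, lintegral_prior (measurable_one.indicator hm)]
    calc _ ≤ ∑' J, (ρ {J} * ENNReal.ofReal x + ENNReal.ofReal (f J)) := by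
          refine ENNReal.tsum_le_tsum fun J => ?_
          by_cases hJ : J ≤ Jb
          · refine le_trans ?_ le_self_add
            gcongr
            calc ∫⁻ Θ, (sieve q Jb M)ᶜ.indicator 1 (⟨J, Θ⟩ : Param q) ∂(τ J)
                ≤ ∫⁻ Θ, {Θ | ∃ l j, M < |Θ l j|}.indicator 1 Θ ∂(τ J) := by
                  refine lintegral_mono fun Θ => ?_
                  by_cases hΘ : ∃ l j, M < |Θ l j|
                  · rw [Set.indicator_of_mem (show Θ ∈
                      {Θ' : Fin q → Fin J → ℝ | ∃ l j, M < |Θ' l j|} from hΘ)]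
                    exact Set.indicator_le_self' (fun _ _ => zero_le) _
                  · rw [Set.indicator_of_notMem]
                    · exact zero_le
                    · simp only [not_exists, not_lt] at hΘ
                      simp only [Set.mem_compl_iff, not_not]
                      exact ⟨hJ, hΘ⟩
              _ ≤ τ J {Θ | ∃ l j, M < |Θ l j|} := lintegral_indicator_one_le _
              _ ≤ ENNReal.ofReal x := by
                  rw [← ofReal_measureReal]
                  exact ENNReal.ofReal_le_ofReal (hτ J hJ)
          · refine le_trans ?_ le_add_self
            calc _ ≤ ρ {J} * ∫⁻ _, 1 ∂(τ J) := by
                  gcongr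
                  exact Set.indicator_le_self' (fun _ _ => zero_le) _
              _ = ρ {J} := by simp
              _ ≤ _ := by
                  rw [← ofReal_measureReal]
                  exact ENNReal.ofReal_le_ofReal (hρ J (not_le.1 hJ))
      _ = ENNReal.ofReal (x + ∑' J, f J) := by
          have h2 : ∑' J, ρ {J} = 1 := by
            simpa using (lintegral_countable' (μ := ρ) (fun _ => 1)).symm
          rw [ENNReal.tsum_add, ENNReal.tsum_mul_right, h2, one_mul,
            ENNReal.ofReal_add hx (tsum_nonneg hf), ENNReal.ofReal_tsum_of_nonneg hf hfs]
  rw [measureReal_def]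
  exact ENNReal.toReal_le_of_le_ofReal (add_nonneg hx (tsum_nonneg hf)) h1

/-- The largest dimension in the sieve. -/
noncomputable def maxDim (α t L : ℝ) (n : ℕ) : ℕ :=
  ⌊L * (optDim α n * Real.log n ^ (1 - t))⌋₊

/-- Halving `L` pays for the floor. The bound by `n²` holds because `y log n = n y^{-2α} ≤ n` and
eventually `L ≤ n`. -/
lemma eventually_maxDim {α t L : ℝ} (hα : 0 < α) (ht0 : 0 ≤ t) (ht : t ≤ 1) (hL : 2 ≤ L) :
    ∀ᶠ n : ℕ in atTop, optDim α n ≤ maxDim α t L n ∧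
      L / 2 * (optDim α n * Real.log n ^ (1 - t)) ≤ maxDim α t L n ∧
      maxDim α t L n * Real.log n ≤ L * (optDim α n * Real.log n * Real.log n ^ (1 - t)) ∧
      (maxDim α t L n : ℝ) ≤ n ^ 2 := by
  filter_upwards [eventually_one_le_log, eventually_ge_atTop ⌈L⌉₊,
    eventually_mul_optDim_rpow hα, (tendsto_optDim hα).eventually_ge_atTop 1] with n hl hn hS hy
  have hn0' : L ≤ n := Nat.ceil_le.1 hn
  have h1 : 1 ≤ Real.log n ^ (1 - t) := Real.one_le_rpow hl (by linarith)
  set x := optDim α n * Real.log n ^ (1 - t) with hx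
  have hyx : optDim α n ≤ x := le_mul_of_one_le_right (by linarith) h1
  have h2 := Nat.lt_floor_add_one (L * x)
  have h3 : (maxDim α t L n : ℝ) ≤ L * x := Nat.floor_le (by nlinarith)
  change L * x < maxDim α t L n + 1 at h2
  have h4 : L / 2 * x ≤ maxDim α t L n := by nlinarith
  refine ⟨by nlinarith, h4, ?_, ?_⟩
  · calc (maxDim α t L n : ℝ) * Real.log n ≤ L * x * Real.log n := by gcongr
      _ = _ := by rw [hx]; ring
  · have h5 : x ≤ n := by
      calc x ≤ optDim α n * Real.log n := by
            rw [hx]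
            gcongr
            calc _ ≤ Real.log n ^ (1 : ℝ) := Real.rpow_le_rpow_of_exponent_le hl (by linarith)
              _ = _ := Real.rpow_one _
        _ = n * optDim α n ^ (-(2 * α)) := hS.symm
        _ ≤ n * 1 := by
            gcongr
            exact Real.rpow_le_one_of_one_le_of_nonpos hy (by linarith)
        _ = n := mul_one _
    nlinarith

lemma exp_neg_mul_le_half {K S w a : ℝ} (hK : 2 * K ≤ Real.exp S) (hw : (a + 1) * S ≤ w) :
    Real.exp (-w) * K ≤ Real.exp (-(a * S)) / 2 := by
  have h2 : Real.exp (-w) ≤ Real.exp (-(a * S)) * Real.exp (-S) := by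
    rw [← Real.exp_add, Real.exp_le_exp]
    linarith
  calc Real.exp (-w) * K ≤ Real.exp (-w) * (Real.exp S / 2) :=
        mul_le_mul_of_nonneg_left (by linarith) (Real.exp_nonneg _)
    _ ≤ Real.exp (-(a * S)) * Real.exp (-S) * (Real.exp S / 2) :=
        mul_le_mul_of_nonneg_right h2 (by positivity)
    _ = _ := by
        rw [Real.exp_neg S]
        field_simp

lemma sq_mul_exp_neg_sq_le_half {x C a S : ℝ} (hx : 1 ≤ x) (ha : 0 ≤ a) (hS : S ≤ x)
    (hC : 2 + a ≤ x * C) : x ^ 2 * Real.exp (-C * x ^ 2) ≤ Real.exp (-(a * S)) / 2 := by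
  have h1 : 2 * x ^ 2 ≤ Real.exp (2 * x) := by
    have := Real.quadratic_le_exp_of_nonneg (x := 2 * x) (by positivity)
    nlinarith
  have h2 : 2 * x ^ 2 * Real.exp (-C * x ^ 2) ≤ Real.exp (-(a * S)) := by
    calc _ ≤ Real.exp (2 * x) * Real.exp (-C * x ^ 2) :=
          mul_le_mul_of_nonneg_right h1 (Real.exp_nonneg _)
      _ ≤ _ := by
        rw [← Real.exp_add, Real.exp_le_exp]
        have h3 := mul_le_mul_of_nonneg_left hC (by linarith : 0 ≤ x)
        have h4 := mul_le_mul_of_nonneg_left hS ha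
        nlinarith
  linarith

lemma exists_sieve {α t₁ t₂ : ℝ} (hα : 0 < α) (ht₂ : 0 ≤ t₂) (ht₂' : t₂ ≤ 1)
    (hDim : DimPriorCond ρ t₁ t₂) (hTail : CoefPriorTail τ) {a : ℝ} (ha : 0 ≤ a) :
    ∃ L ≥ 2, ∃ m : ℕ, ∀ᶠ n : ℕ in atTop,
      (prior ρ τ).real (sieve q (maxDim α t₂ L n) ((n : ℝ) ^ m))ᶜ ≤
        Real.exp (-(a * (optDim α n * Real.log n))) := by
  obtain ⟨c₁, -, c₂, hc₂, j₀, hDim⟩ := hDim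
  obtain ⟨C, hC, t₃, ht₃, M₀, hM₀, hTail⟩ := hTail
  set κ : ℝ := 1 / (2 * (2 * α + 1)) with hκ
  have hκ0 : 0 < κ := by positivity
  have hκ1 : κ ≤ 1 := by
    rw [hκ, div_le_one (by positivity)]
    linarith
  -- The lower bound makes `L c₂ κ / 4 ≥ a + 1`: one factor `1/2` is lost to the floor, the other to
  -- the splitting of the exponent below.
  set L : ℝ := max 2 (4 * (a + 1) / (c₂ * κ)) with hL
  have hL2 : 2 ≤ L := le_max_left _ _
  have hLa : 4 * (a + 1) ≤ L * (c₂ * κ) := by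
    rw [← div_le_iff₀ (by positivity)]
    exact le_max_right _ _
  -- With `m t₃ ≥ 2` the coefficient tail at `n^m` is at most `exp(-C n²)` per dimension, far below
  -- the target since `S ≤ n`.
  set m : ℕ := ⌈2 / t₃⌉₊ + 1
  have hm : 2 ≤ m * t₃ := by
    rw [← div_le_iff₀ ht₃]
    exact (Nat.le_ceil _).trans (by push_cast [m]; linarith)
  refine ⟨L, hL2, m, ?_⟩
  -- Half of the exponent `c₂ J log^{t₂} J` provides a summable geometric series; the other half,
  -- evaluated at the boundary of the sieve, provides the factor `exp(-w)`.
  set f₀ : ℕ → ℝ := fun J => Real.exp (-(c₂ / 2)) ^ J with hf₀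
  have hf₀s : Summable f₀ := summable_geometric_of_lt_one (Real.exp_nonneg _)
    (by rw [Real.exp_lt_one_iff]; linarith)
  set K : ℝ := ∑' J, f₀ J
  have hS : Tendsto (fun n : ℕ => optDim α n * Real.log n) atTop atTop :=
    (tendsto_optDim hα).atTop_mul_atTop₀ (Real.tendsto_log_atTop.comp tendsto_natCast_atTop_atTop)
  filter_upwards [eventually_one_le_log, eventually_maxDim hα ht₂ ht₂' hL2,
    eventually_mul_log_le_log_optDim hα, eventually_mul_optDim_rpow hα,
    (tendsto_optDim hα).eventually_ge_atTop (max j₀ (Real.exp 1)),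
    hS.eventually_ge_atTop (Real.log (2 * max K 1)),
    tendsto_natCast_atTop_atTop.eventually_ge_atTop (max (max M₀ 1) ((2 + a) / C))]
    with n hl hJb hlogy hSn hyj hSK hn
  obtain ⟨hJb1, hJb2, -, hJb4⟩ := hJb
  set Jb := maxDim α t₂ L n
  set y := optDim α n
  set ℓ := Real.log n
  have hn1 : (1 : ℝ) ≤ n := (le_max_right _ _).trans ((le_max_left _ _).trans hn)
  have hnM : M₀ ≤ n := (le_max_left _ _).trans ((le_max_left _ _).trans hn)
  have hnC : 2 + a ≤ n * C := by
    rw [← div_le_iff₀ hC]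
    exact (le_max_right _ _).trans hn
  have hye : Real.exp 1 ≤ y := (le_max_right _ _).trans hyj
  have hy1 : 1 ≤ y := (Real.one_le_exp zero_le_one).trans hye
  have hSle : y * ℓ ≤ n := by
    rw [← hSn]
    refine mul_le_of_le_one_right (by positivity) ?_
    exact Real.rpow_le_one_of_one_le_of_nonpos hy1 (by linarith)
  have hlogJ : ∀ J : ℕ, Jb < J → 1 ≤ Real.log J ∧ κ * ℓ ≤ Real.log J := by
    intro J hJ
    have h1 : y ≤ J := hJb1.trans (by exact_mod_cast hJ.le)
    constructor
    · rw [Real.le_log_iff_exp_le (by linarith)]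
      linarith
    · exact hlogy.trans (Real.log_le_log (by linarith) h1)
  set w := c₂ / 2 * (Jb * (κ * ℓ ^ t₂)) with hw
  have hρ : ∀ J, Jb < J → ρ.real {J} ≤ Real.exp (-w) * f₀ J := by
    intro J hJ
    have h1 : j₀ ≤ J := by
      have : (j₀ : ℝ) ≤ J :=
        ((le_max_left _ _).trans hyj).trans (hJb1.trans (by exact_mod_cast hJ.le))
      exact_mod_cast this
    refine (hDim J h1).2.trans ?_
    rw [hf₀]
    simp only
    rw [← Real.exp_nat_mul, ← Real.exp_add, Real.exp_le_exp]
    obtain ⟨h2, h3⟩ := hlogJ J hJ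
    have h4 : 1 ≤ Real.log J ^ t₂ := Real.one_le_rpow h2 ht₂
    have h5 : κ * ℓ ^ t₂ ≤ Real.log J ^ t₂ := by
      calc κ * ℓ ^ t₂ ≤ κ ^ t₂ * ℓ ^ t₂ := by
            gcongr
            calc κ = κ ^ (1 : ℝ) := (Real.rpow_one _).symm
              _ ≤ κ ^ t₂ := Real.rpow_le_rpow_of_exponent_ge hκ0 hκ1 ht₂'
        _ = (κ * ℓ) ^ t₂ := (Real.mul_rpow hκ0.le (by linarith)).symm
        _ ≤ _ := Real.rpow_le_rpow (by positivity) h3 ht₂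
    have h6 : (Jb : ℝ) ≤ J := by exact_mod_cast hJ.le
    have h7 : Jb * (κ * ℓ ^ t₂) ≤ J * Real.log J ^ t₂ := by gcongr
    have h8 : (J : ℝ) * 1 ≤ J * Real.log J ^ t₂ := by gcongr
    rw [hw]
    nlinarith
  have hτ : ∀ J ≤ Jb, (τ J).real {Θ | ∃ l j, (n : ℝ) ^ m < |Θ l j|} ≤
      (n : ℝ) ^ 2 * Real.exp (-C * n ^ 2) := by
    intro J hJ
    have h1 : (n : ℝ) ≤ (n : ℝ) ^ m := le_self_pow₀ hn1 (by simp [m])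
    refine (hTail J _ (hnM.trans h1)).trans ?_
    have h2 : (J : ℝ) ≤ n ^ 2 := le_trans (by exact_mod_cast hJ) hJb4
    have h3 : (n : ℝ) ^ 2 ≤ ((n : ℝ) ^ m) ^ t₃ := by
      rw [← Real.rpow_natCast, ← Real.rpow_natCast, ← Real.rpow_mul (by positivity)]
      exact Real.rpow_le_rpow_of_exponent_le hn1 (by exact_mod_cast hm)
    exact mul_le_mul h2 (Real.exp_le_exp.2 (by nlinarith)) (Real.exp_nonneg _) (by positivity)
  refine (prior_sieve_compl_le Jb _ (by positivity) hτ
    (fun J => by positivity) (hf₀s.mul_left _) hρ).trans ?_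
  rw [tsum_mul_left]
  have hw' : (a + 1) * (y * ℓ) ≤ w := by
    have h1 : ℓ ^ (1 - t₂) * ℓ ^ t₂ = ℓ := by
      rw [← Real.rpow_add (by linarith)]
      simp
    have hS0 : 0 ≤ y * ℓ := by positivity
    calc (a + 1) * (y * ℓ) ≤ L * (c₂ * κ) / 4 * (y * ℓ) :=
          mul_le_mul_of_nonneg_right (by linarith) hS0
      _ = L * (c₂ * κ) / 4 * (y * (ℓ ^ (1 - t₂) * ℓ ^ t₂)) := by rw [h1]
      _ = c₂ / 2 * (L / 2 * (y * ℓ ^ (1 - t₂)) * (κ * ℓ ^ t₂)) := by ring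
      _ ≤ _ := by
          rw [hw]
          refine mul_le_mul_of_nonneg_left (mul_le_mul_of_nonneg_right hJb2 ?_) (by positivity)
          positivity
  have hSK' : 2 * max K 1 ≤ Real.exp (y * ℓ) := by
    rw [← Real.log_le_iff_le_exp (by positivity)]
    exact hSK
  have hK := exp_neg_mul_le_half (K := K) (by linarith [le_max_left K 1]) hw'
  have hT := sq_mul_exp_neg_sq_le_half hn1 ha hSle hnC
  change _ + Real.exp (-w) * K ≤ _
  linarith

end Sieve

/-! ### Evidence, entropy and sieve bounds at the chosen rates -/

section Rates

variable {q : ℕ} {G : Measure Curve} [IsProbabilityMeasure G] {β₀ : Fin q → ℝ → ℝ}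
  {B₀ : Fin q → ℝ} {ψ : (J : ℕ) → Fin J → ℝ → ℝ} {C K₀ : ℝ}
  {ρ : Measure ℕ} [IsProbabilityMeasure ρ] {τ : (J : ℕ) → Measure (Fin q → Fin J → ℝ)}
  [∀ J, IsProbabilityMeasure (τ J)]

lemma exists_uniform_basisApprox {α H : ℝ} (h : ∀ l, BasisApprox ψ (β₀ l) α H) :
    ∃ D > 0, ∀ J : ℕ, 1 ≤ J → ∃ Θ₀ : Fin q → Fin J → ℝ, (∀ l j, |Θ₀ l j| ≤ H) ∧
      ∀ l, ∀ t ∈ Set.Icc (0 : ℝ) 1, |β₀ l t - series ψ (Θ₀ l) t| ≤ D * (J : ℝ) ^ (-α) := by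
  choose D hD h using h
  have hsum := Finset.sum_nonneg fun l (_ : l ∈ Finset.univ) => (hD l).le
  refine ⟨1 + ∑ l, D l, by linarith, fun J hJ => ?_⟩
  choose Θ₀ h1 h2 using fun l => h l J hJ
  refine ⟨Θ₀, h1, fun l t ht => (h2 l t ht).trans ?_⟩
  gcongr
  have := Finset.single_le_sum (f := D) (fun l _ => (hD l).le) (Finset.mem_univ l)
  linarith

lemma exists_pos_le_catProb {R : ℝ} (h₀ : ∀ l, BddCoef (β₀ l) (B₀ l)) (hB : ∀ l, 0 ≤ B₀ l) :
    ∃ c > 0, ∀ x : Curve, ‖x‖ ≤ R → ∀ k, c ≤ catProb β₀ x k := by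
  obtain ⟨c, hc, h⟩ := exists_pos_le_selProb q ((∑ l, B₀ l) * R)
  refine ⟨c, hc, fun x hx k => h _ (fun l => ((h₀ l).abs_linPred_le x).trans ?_) k⟩
  have h1 := Finset.single_le_sum (f := B₀) (fun l _ => hB l) (Finset.mem_univ l)
  exact mul_le_mul h1 hx (norm_nonneg _) ((hB l).trans h1)

lemma BddCoef.nonneg {β : ℝ → ℝ} {B : ℝ} (h : BddCoef β B) : 0 ≤ B :=
  (abs_nonneg _).trans (h.2 0 ⟨le_rfl, zero_le_one⟩)

/-- Parameters in a small ball around an approximation of `β₀` are uniformly close to `β₀`. -/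
lemma StableBasis.abs_sub_le_of_ball (h : StableBasis ψ C K₀) {J : ℕ} (hJ : 1 ≤ J)
    {Θ Θ₀ : Fin q → Fin J → ℝ} {α s D r : ℝ} (hs : 0 ≤ s) (hr1 : r ≤ 1)
    (h1 : ∀ l, ∀ t ∈ Set.Icc (0 : ℝ) 1, |β₀ l t - series ψ (Θ₀ l) t| ≤ D * (J : ℝ) ^ (-α))
    (h2 : Real.sqrt (∑ l, ∑ j, (Θ l j - Θ₀ l j) ^ 2) ≤ r * (J : ℝ) ^ (-(K₀ + α + s)))
    (l : Fin q) {t : ℝ} (ht : t ∈ Set.Icc (0 : ℝ) 1) :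
    |series ψ (Θ l) t - β₀ l t| ≤ (C + D) * (J : ℝ) ^ (-α) := by
  have hJ1 : (1 : ℝ) ≤ J := by exact_mod_cast hJ
  have hJ0 : (0 : ℝ) < J := by linarith
  have h3 : Real.sqrt (∑ j, (Θ l j - Θ₀ l j) ^ 2) ≤ r * (J : ℝ) ^ (-(K₀ + α + s)) := by
    refine (Real.sqrt_le_sqrt ?_).trans h2
    exact Finset.single_le_sum (f := fun l => ∑ j, (Θ l j - Θ₀ l j) ^ 2)
      (fun l _ => Finset.sum_nonneg fun j _ => sq_nonneg _) (Finset.mem_univ l)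
  have hC := h.pos
  have h4 : |series ψ (Θ l) t - series ψ (Θ₀ l) t| ≤ C * (J : ℝ) ^ (-α) := by
    calc _ ≤ C * (J : ℝ) ^ K₀ * Real.sqrt (∑ j, (Θ l j - Θ₀ l j) ^ 2) := h.stable J _ _ t ht
      _ ≤ C * (J : ℝ) ^ K₀ * (1 * (J : ℝ) ^ (-(K₀ + α + s))) := by
          gcongr
          exact h3.trans (by gcongr)
      _ = C * (J : ℝ) ^ (-α - s) := by
          rw [one_mul, mul_assoc, ← Real.rpow_add hJ0]
          congr 2
          ring
      _ ≤ _ := by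
          gcongr
          linarith
  calc _ = |(series ψ (Θ l) t - series ψ (Θ₀ l) t) - (β₀ l t - series ψ (Θ₀ l) t)| := by ring_nf
    _ ≤ _ := abs_sub _ _
    _ ≤ _ := add_le_add h4 (h1 l t ht)
    _ = _ := by ring

/-- Dimension `⌈y⌉ ≤ 2y` alone suffices. The prior weight of the dimension and the mass of the ball
each cost a multiple of `S`, and the chi-square divergence over `n` observations costs `bS`; the
last `1` in `a` leaves the error probability `exp(-S)`. -/
lemma exists_evidence {α H t₁ t₂ R : ℝ} (hα : 0 < α) (hK₀ : 0 ≤ K₀) (ht₁ : t₁ ≤ 1)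
    (h : StableBasis ψ C K₀) (h₀ : ∀ l, BddCoef (β₀ l) (B₀ l))
    (hR0 : 0 ≤ R) (hR : ∀ᵐ x ∂G, ‖x‖ ≤ R)
    (hApprox : ∀ l, BasisApprox ψ (β₀ l) α H)
    (hDim : DimPriorCond ρ t₁ t₂) (hConc : CoefPriorConc τ H) :
    ∃ a ≥ 0, ∀ᶠ n : ℕ in atTop, (Measure.pi fun _ : Fin n => obsLaw G β₀)
      {D | ∫⁻ p, sampleRatio ψ β₀ D p ∂(prior ρ τ) <
        ENNReal.ofReal (Real.exp (-(a * (optDim α n * Real.log n))))} ≤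
      ENNReal.ofReal (Real.exp (-(optDim α n * Real.log n))) := by
  obtain ⟨c₁, hc₁, c₂, -, j₀, hDim⟩ := hDim
  obtain ⟨c₃, hc₃, ε₀, hε₀, s, hs, hConc⟩ := hConc
  obtain ⟨D, hD, hA⟩ := exists_uniform_basisApprox hApprox
  obtain ⟨c, hc, hcb⟩ := exists_pos_le_catProb (R := R) h₀ fun l => (h₀ l).nonneg
  have hC := h.pos
  set r : ℝ := min ε₀ 1 with hr
  have hr0 : 0 < r := lt_min hε₀ one_pos
  -- In the radius `r J^{-A}`, the power `K₀` offsets the stability constant, `α` matches the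
  -- approximation error, and `s` keeps the radius in the admissible range of the small-ball
  -- condition.
  set A : ℝ := K₀ + α + s with hA'
  have hA0 : 0 < A := by positivity
  set E : ℝ := 2 * (q + 1) * R * (C + D) with hE
  set b : ℝ := (q + 1) * E ^ 2 / (c / 2) with hb
  have hb0 : 0 ≤ b := by positivity
  refine ⟨2 * c₁ + 2 * c₃ * (1 + A) + (b + 1), by positivity, ?_⟩
  have hsmall : Tendsto (fun n => E * optDim α n ^ (-α)) atTop (𝓝 (E * 0)) :=
    ((tendsto_rpow_neg_atTop hα).comp (tendsto_optDim hα)).const_mul E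
  rw [mul_zero] at hsmall
  filter_upwards [eventually_one_le_log, eventually_optDim_le hα,
    eventually_mul_optDim_rpow hα, (tendsto_optDim hα).eventually_ge_atTop (max j₀ (Real.exp 1)),
    hsmall.eventually_le_const (by positivity : 0 < c / 2),
    (Real.tendsto_log_atTop.comp tendsto_natCast_atTop_atTop).eventually_ge_atTop
      (Real.log (1 / r))] with n hl hyn hSn hyj hsm hlr
  simp only [Function.comp_apply] at hlr
  set y := optDim α n
  set ℓ := Real.log n
  have hye : Real.exp 1 ≤ y := (le_max_right _ _).trans hyj
  have hy1 : 1 ≤ y := (Real.one_le_exp zero_le_one).trans hye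
  set J := ⌈y⌉₊ with hJdef
  have hyJ : y ≤ J := Nat.le_ceil y
  have hJ1 : 1 ≤ J := Nat.one_le_ceil_iff.2 (by linarith)
  have hJ1' : (1 : ℝ) ≤ J := by exact_mod_cast hJ1
  have hJ2 : (J : ℝ) ≤ 2 * y := by linarith [Nat.ceil_lt_add_one (by linarith : 0 ≤ y)]
  have hJn : (J : ℝ) ≤ n := by exact_mod_cast Nat.ceil_le.2 hyn
  have hjJ : j₀ ≤ J := by exact_mod_cast ((le_max_left _ _).trans hyj).trans hyJ
  have hlogJ1 : 1 ≤ Real.log J := by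
    rw [Real.le_log_iff_exp_le (by linarith)]
    linarith
  have hlogJ2 : Real.log J ≤ ℓ := Real.log_le_log (by linarith) hJn
  obtain ⟨Θ₀, hΘ₀, hΘ₀'⟩ := hA J hJ1
  set η : ℝ := r * (J : ℝ) ^ (-A) with hη
  have hη0 : 0 < η := by positivity
  have hηle : η ≤ ε₀ * (J : ℝ) ^ (-s) := by
    rw [hη]
    have : (J : ℝ) ^ (-A) ≤ (J : ℝ) ^ (-s) :=
      Real.rpow_le_rpow_of_exponent_le hJ1' (by rw [hA']; linarith)
    have h2 : r ≤ ε₀ := min_le_left _ _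
    gcongr
  set U : Set (Fin q → Fin J → ℝ) :=
    {Θ | Real.sqrt (∑ l, ∑ j, (Θ l j - Θ₀ l j) ^ 2) ≤ η} with hU
  have hUm : MeasurableSet U := measurableSet_le (by fun_prop) measurable_const
  have hU1 : Real.exp (-(2 * c₃ * (1 + A) * (y * ℓ))) ≤ (τ J).real U := by
    refine le_trans (Real.exp_le_exp.2 ?_) (hConc J hJ1 Θ₀ hΘ₀ η hη0 hηle)
    have h1 : Real.log (1 / η) ≤ (1 + A) * ℓ := by
      have h2 : Real.log (1 / η) = Real.log (1 / r) + A * Real.log J := by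
        rw [hη, one_div, Real.log_inv, Real.log_mul hr0.ne' (by positivity),
          Real.log_rpow (by linarith), one_div, Real.log_inv]
        ring
      rw [h2]
      nlinarith
    have h3 : (J : ℝ) * Real.log (1 / η) ≤ 2 * y * ((1 + A) * ℓ) :=
      mul_le_mul hJ2 h1 (by
        refine Real.log_nonneg ?_
        rw [le_div_iff₀ hη0, one_mul, hη]
        have : (J : ℝ) ^ (-A) ≤ 1 := Real.rpow_le_one_of_one_le_of_nonpos hJ1' (by linarith)
        exact mul_le_one₀ (min_le_right _ _) (by positivity) this) (by positivity)
    have := mul_le_mul_of_nonneg_left h3 hc₃.le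
    linarith
  have hρ : Real.exp (-(2 * c₁ * (y * ℓ))) ≤ ρ.real {J} := by
    refine le_trans (Real.exp_le_exp.2 ?_) (hDim J hjJ).1
    have h1 : Real.log J ^ t₁ ≤ ℓ := by
      calc _ ≤ Real.log J ^ (1 : ℝ) := Real.rpow_le_rpow_of_exponent_le hlogJ1 ht₁
        _ = Real.log J := Real.rpow_one _
        _ ≤ ℓ := hlogJ2
    have h3 : (J : ℝ) * Real.log J ^ t₁ ≤ 2 * y * ℓ :=
      mul_le_mul hJ2 h1 (by positivity) (by positivity)
    have := mul_le_mul_of_nonneg_left h3 hc₁.le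
    linarith
  have hJα : (J : ℝ) ^ (-α) ≤ y ^ (-α) :=
    Real.rpow_le_rpow_of_nonpos (by linarith) hyJ (by linarith)
  have hclose : ∀ Θ ∈ U, ∀ x : Curve, ‖x‖ ≤ R → ∀ k,
      |catProb (coefFun ψ ⟨J, Θ⟩) x k - catProb β₀ x k| ≤ E * y ^ (-α) := by
    intro Θ hΘ x hx k
    refine (abs_catProb_sub_le (d := (C + D) * (J : ℝ) ^ (-α)) (by positivity)
      (h.bddCoef_coefFun ⟨J, Θ⟩) h₀ (fun l t ht =>
        h.abs_sub_le_of_ball hJ1 hs (min_le_right _ _) hΘ₀' hΘ l ht) hx k).trans ?_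
    calc _ = E * (J : ℝ) ^ (-α) := by rw [hE]; ring
      _ ≤ _ := by gcongr
  refine (h.measure_evidence_le (J := J) (U := U) (c := c / 2) (d := E * y ^ (-α))
    (t := (b + 1) * (y * ℓ)) h₀ hUm (by positivity) (fun Θ hΘ => ?_) (fun Θ hΘ => ?_) ?_).trans ?_
  · filter_upwards [hR] with x hx k
    have h1 := abs_le.1 (hclose Θ hΘ x hx k)
    have h2 := hcb x hx k
    linarith
  · filter_upwards [hR] with x hx k
    exact hclose Θ hΘ x hx k
  · calc Real.exp (-((2 * c₁ + 2 * c₃ * (1 + A) + (b + 1)) * (y * ℓ))) =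
        Real.exp (-(2 * c₁ * (y * ℓ))) * Real.exp (-(2 * c₃ * (1 + A) * (y * ℓ))) *
          Real.exp (-((b + 1) * (y * ℓ))) := by
          rw [← Real.exp_add, ← Real.exp_add]
          ring_nf
      _ ≤ _ := by gcongr
  · refine ENNReal.ofReal_le_ofReal (Real.exp_le_exp.2 (le_of_eq ?_))
    have h1 : (y ^ (-α)) ^ 2 = y ^ (-(2 * α)) := by
      rw [← Real.rpow_natCast, ← Real.rpow_mul (by linarith)]
      congr 1
      push_cast
      ring
    have h2 : (n : ℝ) * ((q + 1) * (E * y ^ (-α)) ^ 2 / (c / 2)) = b * (y * ℓ) := by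
      rw [mul_pow, h1, ← hSn, hb]
      ring
    rw [h2]
    ring

/-- Every coordinate has polynomially many cells, so the log-number of cells is of order dimension
times `log n`. -/
lemma eventually_cells {α t L : ℝ} (hα : 0 < α) (ht0 : 0 ≤ t) (ht : t ≤ 1) (hL : 2 ≤ L)
    (q k : ℕ) :
    ∀ᶠ n : ℕ in atTop, ((maxDim α t L n : ℝ) + 1) * ((2 * n ^ k + 1 : ℕ) : ℝ) ^ (q * maxDim α t L n)
      ≤ Real.exp ((1 + q * (k + 2)) * (L * (optDim α n * Real.log n * Real.log n ^ (1 - t)))) := by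
  filter_upwards [eventually_one_le_log, eventually_maxDim hα ht0 ht hL,
    eventually_ge_atTop 2] with n hl hJ hn
  obtain ⟨-, -, hJ, -⟩ := hJ
  set Jb := maxDim α t L n
  have hn0 : (0 : ℝ) < n := by exact_mod_cast (by omega : 0 < n)
  have h1 : (Jb : ℝ) + 1 ≤ Real.exp (Jb * Real.log n) :=
    (Real.add_one_le_exp _).trans (Real.exp_le_exp.2 (le_mul_of_one_le_right (by positivity) hl))
  have h2 : ((2 * n ^ k + 1 : ℕ) : ℝ) ≤ Real.exp ((k + 2) * Real.log n) := by
    have h3 : 2 * n ^ k + 1 ≤ n ^ (k + 2) := by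
      have h4 : 1 ≤ n ^ k := Nat.one_le_pow _ _ (by omega)
      calc 2 * n ^ k + 1 ≤ n ^ k * 4 := by omega
        _ ≤ n ^ k * n ^ 2 := Nat.mul_le_mul_left _ (by nlinarith)
        _ = n ^ (k + 2) := (pow_add _ _ _).symm
    have h5 : Real.exp ((k + 2) * Real.log n) = (n : ℝ) ^ (k + 2) := by
      rw [← Real.exp_log (pow_pos hn0 (k + 2)), Real.log_pow]
      push_cast
      rfl
    rw [h5]
    exact_mod_cast h3
  calc _ ≤ Real.exp (Jb * Real.log n) * Real.exp ((k + 2) * Real.log n) ^ (q * Jb) := by gcongr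
    _ = Real.exp ((1 + q * (k + 2)) * (Jb * Real.log n)) := by
        rw [← Real.exp_nat_mul, ← Real.exp_add]
        push_cast
        ring_nf
    _ ≤ _ := by gcongr

/-- With threshold exponent `nη²/8`, half of it is lost to the square root, leaving `nη²/16` against
the entropy. The bound is uniform in `η`, which later depends on `n`. -/
lemma exists_sieve_likelihood {α t L R : ℝ} (hα : 0 < α) (hK₀ : 0 ≤ K₀) (ht0 : 0 ≤ t) (ht : t ≤ 1)
    (hL : 2 ≤ L) (m : ℕ) (h : StableBasis ψ C K₀) (h₀ : ∀ l, BddCoef (β₀ l) (B₀ l))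
    (hR : ∀ᵐ x ∂G, ‖x‖ ≤ R) :
    ∃ b : ℝ, ∀ᶠ n : ℕ in atTop, ∀ η ≥ 0, (Measure.pi fun _ : Fin n => obsLaw G β₀)
      {D | ∃ p ∈ sieve q (maxDim α t L n) ((n : ℝ) ^ m), η ≤ catDist G (coefFun ψ p) β₀ ∧
        ENNReal.ofReal (Real.exp (-(n * η ^ 2 / 8))) < sampleRatio ψ β₀ D p} ≤
      ENNReal.ofReal (Real.exp (b * (optDim α n * Real.log n * Real.log n ^ (1 - t)) -
        n * η ^ 2 / 16)) := by
  set k : ℕ := ⌈2 * K₀⌉₊ with hk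
  -- For mesh `n^{-A}` the cell error is at most `n · n^k · n² · n^{-A} = n^{-4} = δ`; then `n √δ =
  -- 1/n` is negligible.
  set A : ℕ := k + 7 with hA
  refine ⟨(1 + q * ((m + A : ℕ) + 2)) * L + (q + 1), ?_⟩
  have hC := h.pos
  filter_upwards [eventually_one_le_log, eventually_maxDim hα ht0 ht hL,
    eventually_cells hα ht0 ht hL q (m + A), eventually_ge_atTop 2,
    (tendsto_optDim hα).eventually_ge_atTop 1,
    tendsto_natCast_atTop_atTop.eventually_ge_atTop (2 * (q + 1) * R * C)]
    with n hl hJ hcells hn hy hnC η hη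
  obtain ⟨-, -, -, hJ⟩ := hJ
  set Jb := maxDim α t L n
  have hn1 : (1 : ℝ) ≤ n := by exact_mod_cast (by omega : 1 ≤ n)
  have hn0 : (0 : ℝ) < n := by linarith
  have hT : 1 ≤ optDim α n * Real.log n * Real.log n ^ (1 - t) := by
    have h1 : 1 ≤ Real.log n ^ (1 - t) := Real.one_le_rpow hl (by linarith)
    exact one_le_mul_of_one_le_of_one_le (one_le_mul_of_one_le_of_one_le hy hl) h1
  refine (h.measure_sieve_le (Jb := Jb) (N := 2 * n ^ (m + A) + 1) (M := (n : ℝ) ^ m)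
    (m := ((n : ℝ) ^ A)⁻¹) (δ := ((n : ℝ) ^ 4)⁻¹) (η := η) (b := n * η ^ 2 / 8) h₀ hR
    (by positivity) ?_ (by omega) (by positivity) hη ?_).trans ?_
  · rw [div_inv_eq_mul, mul_assoc, ← pow_add]
    push_cast
    linarith
  · intro J hJb
    have hJ2 : (J : ℝ) ≤ n ^ 2 := le_trans (by exact_mod_cast hJb) hJ
    have h1 : (J : ℝ) ^ K₀ ≤ (n : ℝ) ^ k := by
      calc (J : ℝ) ^ K₀ ≤ ((n : ℝ) ^ 2) ^ K₀ := Real.rpow_le_rpow (by positivity) hJ2 hK₀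
        _ = (n : ℝ) ^ (2 * K₀) := by
            rw [← Real.rpow_natCast, ← Real.rpow_mul hn0.le]
            norm_num
        _ ≤ (n : ℝ) ^ (k : ℝ) := Real.rpow_le_rpow_of_exponent_le hn1 (Nat.le_ceil _)
        _ = _ := Real.rpow_natCast _ _
    calc 2 * (q + 1) * R * (C * (J : ℝ) ^ K₀ * (J * ((n : ℝ) ^ A)⁻¹))
        = (2 * (q + 1) * R * C) * ((J : ℝ) ^ K₀ * J) * ((n : ℝ) ^ A)⁻¹ := by ring
      _ ≤ n * ((n : ℝ) ^ k * n ^ 2) * ((n : ℝ) ^ A)⁻¹ := by gcongr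
      _ = ((n : ℝ) ^ 4)⁻¹ := by
          rw [hA, pow_add]
          field_simp
  · refine ENNReal.ofReal_le_ofReal ?_
    have h2 : √((n : ℝ) ^ 4)⁻¹ = ((n : ℝ) ^ 2)⁻¹ := by
      rw [Real.sqrt_inv]
      congr 1
      rw [show (n : ℝ) ^ 4 = ((n : ℝ) ^ 2) ^ 2 by ring, Real.sqrt_sq (by positivity)]
    have h3 : n * ((q + 1) * ((n : ℝ) ^ 2)⁻¹) ≤ (q + 1) *
        (optDim α n * Real.log n * Real.log n ^ (1 - t)) := by
      calc n * ((q + 1) * ((n : ℝ) ^ 2)⁻¹) = (q + 1) * (n : ℝ)⁻¹ := by field_simp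
        _ ≤ _ := by
          gcongr
          exact (inv_le_one_of_one_le₀ hn1).trans hT
    rw [h2]
    calc _ ≤ Real.exp ((1 + q * ((m + A : ℕ) + 2)) *
          (L * (optDim α n * Real.log n * Real.log n ^ (1 - t)))) *
          Real.exp (n * η ^ 2 / 8 / 2 + n * (-(η ^ 2 / 8) + (q + 1) * ((n : ℝ) ^ 2)⁻¹)) := by
          gcongr
      _ ≤ _ := by
          rw [← Real.exp_add, Real.exp_le_exp]
          push_cast
          linarith

end Rates

/-! ### Assembly of the posterior bound -/

/-- A non-asymptotic bound for the posterior probability of the complement of a ball. -/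
lemma StableBasis.measure_posteriorProb_le {q n : ℕ} {G : Measure Curve} [IsProbabilityMeasure G]
    {β₀ : Fin q → ℝ → ℝ} {B₀ : Fin q → ℝ} {ψ : (J : ℕ) → Fin J → ℝ → ℝ} {C K₀ : ℝ}
    {ρ : Measure ℕ} [IsProbabilityMeasure ρ] {τ : (J : ℕ) → Measure (Fin q → Fin J → ℝ)}
    [∀ J, IsProbabilityMeasure (τ J)] (h : StableBasis ψ C K₀)
    (h₀ : ∀ l, BddCoef (β₀ l) (B₀ l)) {F : Set (Param q)} (hF : MeasurableSet F)
    {η a b c x u v : ℝ} {δ : ℝ≥0∞} (hδ : ENNReal.ofReal (Real.exp (a - b) + Real.exp (a - c)) < δ)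
    (h1 : (Measure.pi fun _ : Fin n => obsLaw G β₀)
      {D | ∫⁻ p, sampleRatio ψ β₀ D p ∂(prior ρ τ) < ENNReal.ofReal (Real.exp (-a))} ≤
        ENNReal.ofReal u)
    (h2 : (Measure.pi fun _ : Fin n => obsLaw G β₀)
      {D | ∃ p ∈ F, η ≤ catDist G (coefFun ψ p) β₀ ∧
        ENNReal.ofReal (Real.exp (-b)) < sampleRatio ψ β₀ D p} ≤ ENNReal.ofReal v)
    (h3 : (prior ρ τ).real Fᶜ ≤ x) :
    (Measure.pi fun _ : Fin n => obsLaw G β₀)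
      {D | δ ≤ posteriorProb (prior ρ τ) ψ D {p | η ≤ catDist G (coefFun ψ p) β₀}} ≤
      ENNReal.ofReal u + ENNReal.ofReal v + ENNReal.ofReal (x * Real.exp c) := by
  have h3' := h.measure_sieve_compl_le (n := n) (G := G) h₀ hF.compl (c := c) h3
  refine (measure_mono ?_).trans ((measure_union_le _ _).trans
    (add_le_add ((measure_union_le _ _).trans (add_le_add h1 h2)) h3'))
  intro D hD
  by_contra hcon
  simp only [Set.mem_union, Set.mem_ofPred_eq, not_or, not_lt, not_exists, not_and, not_le]
    at hcon hD
  obtain ⟨⟨hc1, hc2⟩, hc3⟩ := hcon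
  exact absurd hδ (not_lt.2 (hD.trans (h.posteriorProb_le h₀ hc1
    (fun p hp hpB => hc2 p hp hpB) hc3.le)))

/-- The posterior contracts at every rate that is at least of the order of
`n^{-α/(2α+1)} (log n)^{α/(2α+1)+(1-t₂)/2}`. -/
theorem contractsAt_of_isBigO {q : ℕ} {G : Measure Curve} [IsProbabilityMeasure G]
    (hX : ∃ M : ℝ, ∀ᵐ x ∂G, ‖x‖ ≤ M) {ψ : (J : ℕ) → Fin J → ℝ → ℝ}
    (hψ : ∀ J j, Measurable (ψ J j)) {β₀ : Fin q → ℝ → ℝ} {α H K₀ : ℝ} (hα : 0 < α)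
    (hK₀ : 0 ≤ K₀) (hApprox : ∀ l, BasisApprox ψ (β₀ l) α H) (hStable : BasisStable ψ K₀)
    {ρ : Measure ℕ} [IsProbabilityMeasure ρ] {τ : (J : ℕ) → Measure (Fin q → Fin J → ℝ)}
    [∀ J, IsProbabilityMeasure (τ J)] {t₁ t₂ : ℝ} (ht₂ : 0 ≤ t₂) (ht₂₁ : t₂ ≤ t₁) (ht₁ : t₁ ≤ 1)
    (hDim : DimPriorCond ρ t₁ t₂) (hConc : CoefPriorConc τ H) (hTail : CoefPriorTail τ)
    {ε : ℕ → ℝ} (hε_pos : ∀ n, 0 < ε n)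
    (hε : (fun n : ℕ => (n : ℝ) ^ (-α / (2 * α + 1)) *
        Real.log n ^ (α / (2 * α + 1) + (1 - t₂) / 2)) =O[atTop] ε) :
    ContractsAt G (prior ρ τ) ψ β₀ ε := by
  obtain ⟨C, hS⟩ := hStable.exists_stableBasis hψ
  choose B₀ h₀ using fun l => (hApprox l).exists_bddCoef hα hS
  obtain ⟨R', hR'⟩ := hX
  have hR : ∀ᵐ x ∂G, ‖x‖ ≤ max R' 0 := hR'.mono fun x hx => hx.trans (le_max_left _ _)
  have ht₂' : t₂ ≤ 1 := ht₂₁.trans ht₁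
  obtain ⟨a, ha, hev⟩ := exists_evidence (τ := τ) hα hK₀ ht₁ hS h₀ (le_max_right R' 0) hR hApprox
    hDim hConc
  -- The sieve complement must beat the evidence `exp(-aS)`: one further `S` is used by the Markov
  -- threshold `exp(-(a+1)S)`, and the second makes the error probability `exp(-S)`.
  obtain ⟨L, hL, m, hsv⟩ := exists_sieve hα ht₂ ht₂' hDim hTail (a := a + 2) (by linarith)
  obtain ⟨b, hlk⟩ := exists_sieve_likelihood hα hK₀ ht₂ ht₂' hL m hS h₀ hR
  obtain ⟨c', hc'⟩ := hε.bound
  set c : ℝ := max c' 1 with hcdef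
  have hc0 : 0 < c := lt_max_of_lt_right one_pos
  intro M hM δ hδ
  set S : ℕ → ℝ := fun n => optDim α n * Real.log n with hSdef
  have hStop : Tendsto S atTop atTop := (tendsto_optDim hα).atTop_mul_atTop₀
    (Real.tendsto_log_atTop.comp tendsto_natCast_atTop_atTop)
  have hexp : ∀ k > 0, Tendsto (fun n => Real.exp (-(k * S n))) atTop (𝓝 0) := fun k hk =>
    Real.tendsto_exp_neg_atTop_nhds_zero.comp (hStop.const_mul_atTop hk)
  have hlim : Tendsto (fun n => ENNReal.ofReal (Real.exp (-(1 * S n))) +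
      ENNReal.ofReal (Real.exp (-(1 * S n))) + ENNReal.ofReal (Real.exp (-(1 * S n))))
      atTop (𝓝 0) := by
    have h1 := ENNReal.tendsto_ofReal (hexp 1 one_pos)
    rw [ENNReal.ofReal_zero] at h1
    simpa using (h1.add h1).add h1
  have hδlim : ∀ᶠ n in atTop,
      ENNReal.ofReal (Real.exp (-(1 * S n)) + Real.exp (-(1 * S n))) < δ := by
    have h1 := ENNReal.tendsto_ofReal ((hexp 1 one_pos).add (hexp 1 one_pos))
    rw [add_zero, ENNReal.ofReal_zero] at h1
    exact h1.eventually_lt_const hδ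
  refine tendsto_of_tendsto_of_tendsto_of_le_of_le' tendsto_const_nhds hlim
    (Eventually.of_forall fun _ => zero_le) ?_
  filter_upwards [hev, hsv, hlk, hδlim, hc', eventually_mul_rate_sq hα t₂, eventually_one_le_log,
    (tendsto_optDim hα).eventually_ge_atTop 1,
    hM.eventually_ge_atTop (c * (16 * (|b| + a + 1) + 1)), eventually_gt_atTop 0]
    with n hev hsv hlk hδn hcn hrate hl hy hMn hn0
  have hn0' : (0 : ℝ) < n := Nat.cast_pos.2 hn0
  set r : ℝ := (n : ℝ) ^ (-α / (2 * α + 1)) * Real.log n ^ (α / (2 * α + 1) + (1 - t₂) / 2)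
  have hr0 : 0 ≤ r := by positivity
  have hrε : r ≤ c * ε n := by
    rw [Real.norm_of_nonneg hr0, Real.norm_of_nonneg (hε_pos n).le] at hcn
    exact hcn.trans (mul_le_mul_of_nonneg_right (le_max_left _ _) (hε_pos n).le)
  -- Chosen so that `nη²/16 ≥ (|b| + a + 1) T` with `T ≥ S`, which dominates both the entropy `bT`
  -- and the evidence exponent. The divergence of `M n` also absorbs the constant `c` of the rate
  -- comparison.
  set w : ℝ := 16 * (|b| + a + 1) + 1 with hw
  have hw1 : 1 ≤ w := by have := abs_nonneg b; linarith
  have hη : w * r ≤ M n * ε n := by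
    calc w * r ≤ w * (c * ε n) := by gcongr
      _ = c * w * ε n := by ring
      _ ≤ M n * ε n := mul_le_mul_of_nonneg_right hMn (hε_pos n).le
  have hη0 : 0 ≤ M n * ε n := le_trans (by positivity) hη
  set T : ℝ := optDim α n * Real.log n * Real.log n ^ (1 - t₂) with hT
  have hS0 : 0 ≤ S n := by simp only [hSdef]; positivity
  have hST : S n ≤ T := le_mul_of_one_le_right hS0 (Real.one_le_rpow hl (by linarith))
  have hQ : w * T ≤ n * (M n * ε n) ^ 2 := by
    calc w * T ≤ w ^ 2 * T := by
          have : 0 ≤ T := hS0.trans hST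
          gcongr
          nlinarith
      _ = n * (w * r) ^ 2 := by rw [← hrate]; ring
      _ ≤ _ := by gcongr
  have hQ' : 16 * (|b| + a + 1) * T ≤ n * (M n * ε n) ^ 2 := by
    refine le_trans ?_ hQ
    have : 0 ≤ T := hS0.trans hST
    gcongr
    linarith
  have hbT : b * T ≤ |b| * T := mul_le_mul_of_nonneg_right (le_abs_self b) (hS0.trans hST)
  have haT : (a + 1) * S n ≤ (a + 1) * T := by gcongr
  have hbT0 : 0 ≤ |b| * T := mul_nonneg (abs_nonneg b) (hS0.trans hST)
  have haS : 0 ≤ (a + 1) * S n := by positivity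
  have haS' : 0 ≤ a * S n := by positivity
  refine (hS.measure_posteriorProb_le h₀ (measurableSet_sieve q _ _) (a := a * S n)
    (c := (a + 1) * S n) ?_ hev (hlk _ hη0) hsv).trans ?_
  · refine lt_of_le_of_lt (ENNReal.ofReal_le_ofReal ?_) hδn
    refine add_le_add (Real.exp_le_exp.2 ?_) (Real.exp_le_exp.2 ?_)
    · linarith
    · linarith
  · refine add_le_add (add_le_add (ENNReal.ofReal_le_ofReal ?_) (ENNReal.ofReal_le_ofReal ?_))
      (ENNReal.ofReal_le_ofReal ?_)
    · rw [one_mul]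
    · refine Real.exp_le_exp.2 ?_
      linarith
    · rw [← Real.exp_add]
      refine Real.exp_le_exp.2 (le_of_eq ?_)
      simp only [hSdef]
      ring

end FunProbit

theorem theorem3
    (q : ℕ) -- there are `K = q + 1` categories
    -- the law of the functional covariate, with bounded `L¹` norm
    (G : MeasureTheory.Measure FunProbit.Curve) [MeasureTheory.IsProbabilityMeasure G]
    (hX : ∃ M : ℝ, ∀ᵐ x ∂G, ‖x‖ ≤ M)
    -- the basis and the true coefficient functions
    (ψ : (J : ℕ) → Fin J → ℝ → ℝ) (hψ : ∀ J j, Measurable (ψ J j))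
    (β₀ : Fin q → ℝ → ℝ)
    (α H K₀ : ℝ) (hα : 0 < α) (hK₀ : 0 ≤ K₀)
    (hApprox : ∀ l, FunProbit.BasisApprox ψ (β₀ l) α H)
    (hStable : FunProbit.BasisStable ψ K₀)
    -- the prior
    (ρ : MeasureTheory.Measure ℕ) [MeasureTheory.IsProbabilityMeasure ρ]
    (τ : (J : ℕ) → MeasureTheory.Measure (Fin q → Fin J → ℝ))
    [∀ J, MeasureTheory.IsProbabilityMeasure (τ J)]
    (t₁ t₂ : ℝ) (ht₂ : 0 ≤ t₂) (ht₂₁ : t₂ ≤ t₁) (ht₁ : t₁ ≤ 1)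
    (hDim : FunProbit.DimPriorCond ρ t₁ t₂)
    (hConc : FunProbit.CoefPriorConc τ H)
    (hTail : FunProbit.CoefPriorTail τ)
    -- the rate
    (ε : ℕ → ℝ) (hε_pos : ∀ n, 0 < ε n)
    (hε : ε =Θ[atTop] fun n : ℕ =>
      (n : ℝ) ^ (-α / (2 * α + 1)) *
        Real.log n ^ (α / (2 * α + 1) + (1 - t₂) / 2)) :
    FunProbit.ContractsAt G (FunProbit.prior ρ τ) ψ β₀ ε := by
  exact FunProbit.contractsAt_of_isBigO hX hψ hα hK₀ hApprox hStable ht₂ ht₂₁ ht₁ hDim hConc hTail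
    hε_pos hε.2
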